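/- Let $\mathcal F$ be an ordinary differential field of characteristic $0$ with derivation $\delta$, and let $\mathcal E$ be a universal differential extension field of $\mathcal F$. Let $\mathcal F[\delta]$ be the Ore ring of linear differential operators ($\delta c=c\,\delta+\delta(c)$ for $c\in\mathcal F$), and let $F=L_1(x)+L_2(y)+a\in\mathcal F\{x,y\}\setminus\mathcal F$ with $L_1,L_2\in\mathcal F[\delta]$ and $a\in\mathcal F$. Let $\operatorname{sat}(F)=[F]:(S_FI_F)^\infty$ be the saturation ideal of $F$ ($S_F$ and $I_F$ are the separant and the initial of $F$ under any fixed ranking), and let $(\mathcal C,F)$ denote the differential curve $\mathcal C=\mathbb V(\operatorname{sat}(F))\subset\mathcal E^2$. A differential rational parametrization of $(\mathcal C,F)$ is a generic point of $\mathcal C$, i.e. a point whose ideal of vanishing differential polynomials over $\mathcal F$ is $\operatorname{sat}(F)$, of the form $\mathcal P(u)=\bigl(\tfrac{P_1(u)}{Q_1(u)},\tfrac{P_2(u)}{Q_2(u)}\bigr)$ with $u\in\mathcal E$ differentially transcendental over $\mathcal F$, $P_i,Q_i\in\mathcal F\{u\}$, $Q_i\neq0$ and $\gcd(P_i,Q_i)=1$.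 It is proper if $\mathcal F\langle\mathcal P(u)\rangle=\mathcal F\langle u\rangle$. It is a linear differential polynomial parametrization if both coordinates are differential polynomials in $u$ over $\mathcal F$ of degree at most $1$, not both in $\mathcal F$. The curve is unirational if $F$ is irreducible and $(\mathcal C,F)$ has a differential rational parametrization. Let $\operatorname{gcld}(L_1,L_2)$ denote the monic common left divisor of highest degree of $L_1,L_2$ in $\mathcal F[\delta]$. Theorem. $(\mathcal C,F)$ is unirational if and only if $\operatorname{gcld}(L_1,L_2)=1$. Furthermore, if $(\mathcal C,F)$ is unirational, then it has a proper linear differential polynomial parametrization, and one is given explicitly as follows. Run the extended left Euclidean algorithm on $(L_1,L_2)$: start with $(R_0,A_0,B_0)=(L_1,1,0)$, $(R_1,A_1,B_1)=(L_2,0,1)$ and $i=1$; while $R_i\neq0$, increase $i$ by $1$, write $R_{i-2}=R_{i-1}Q_{i-1}+R_i$ with $\deg R_i<\deg R_{i-1}$, and put $A_i=A_{i-2}-A_{i-1}Q_{i-1}$, $B_i=B_{i-2}-B_{i-1}Q_{i-1}$; let $n$ be the final value of $i$. Then $c:=R_{n-1}\in\mathcal F\setminus\{0\}$ and, for every $u\in\mathcal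 E$ differentially transcendental over $\mathcal F$, $$\mathcal P(u)=\Bigl(A_n(u)+A_{n-1}\bigl(-\tfrac ac\bigr),\;B_n(u)+B_{n-1}\bigl(-\tfrac ac\bigr)\Bigr)$$ is a proper linear differential polynomial parametrization of $(\mathcal C,F)$. -/

import Mathlib

noncomputable section

namespace DiffAlg

open Differential

/-! ### Iterated derivatives -/

/-- The `k`-th derivative `z ↦ z^(k)` in a differential ring. -/
def der {K : Type*} [CommRing K] [Differential K] (k : ℕ) : K → K :=
  (fun z : K => z′)^[k]

/-! ### The Ore ring `F[δ]` of linear differential operators -/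

/-- Linear differential operators `∑ cᵢ δ ^ i` with coefficients (written on the left) in `F`.
As a left `F`-module this is the module of polynomials; the multiplication is the skew one given
by `δ * c = c * δ + c′`, see `DiffOp.delta_mul_ofField`. -/
def DiffOp (F : Type*) [CommRing F] : Type _ := Polynomial F

namespace DiffOp

section Basic

variable {F : Type*} [CommRing F]

instance : AddCommGroup (DiffOp F) := inferInstanceAs (AddCommGroup (Polynomial F))

/-- The polynomial with the same (left) coefficients. -/
def toPoly : DiffOp F ≃+ Polynomial F := AddEquiv.refl _

/-- The coefficient of `δ ^ i`. -/
def coeff (L : DiffOp F) (i : ℕ) : F := (toPoly L).coeff i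

/-- The degree in `δ`; the zero operator has degree `⊥`. -/
def degree (L : DiffOp F) : WithBot ℕ := (toPoly L).degree

/-- An operator is monic if its leading coefficient is `1`. -/
def Monic (L : DiffOp F) : Prop := (toPoly L).Monic

/-- The operator `c δ ^ 0` of multiplication by `c`. -/
def ofField (c : F) : DiffOp F := toPoly.symm (Polynomial.C c)

/-- The operator `δ`. -/
def delta : DiffOp F := toPoly.symm Polynomial.X

/-- The value `∑ cᵢ z^(i)` of the operator `∑ cᵢ δ ^ i` at an element `z` of a differential
`F`-algebra. -/
def apply {K : Type*} [CommRing K] [Differential K] [Algebra F K] (L : DiffOp F) (z : K) : K :=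
  (toPoly L).sum fun i c => algebraMap F K c * der i z

end Basic

section Mul

variable {F : Type*} [CommRing F] [Differential F]

/-- Left multiplication by `δ`: `∑ cᵢ δ ^ i ↦ ∑ (cᵢ δ ^ (i + 1) + cᵢ′ δ ^ i)`. -/
def deltaMul : Module.End ℤ (Polynomial F) :=
  LinearMap.mulLeft ℤ Polynomial.X + (mapCoeffs : Derivation ℤ _ (Polynomial F)).toLinearMap

/-- Left multiplication by `∑ cᵢ δ ^ i`. -/
def leftMul (p : Polynomial F) : Module.End ℤ (Polynomial F) :=
  p.sum fun i c => LinearMap.mulLeft ℤ (Polynomial.C c) * deltaMul ^ i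

instance : Mul (DiffOp F) := ⟨fun L M => toPoly.symm (leftMul (toPoly L) (toPoly M))⟩

instance : One (DiffOp F) := ⟨ofField 1⟩

theorem deltaMul_apply (q : Polynomial F) :
    deltaMul q = Polynomial.X * q + mapCoeffs q := rfl

theorem toPoly_mul (L M : DiffOp F) : toPoly (L * M) = leftMul (toPoly L) (toPoly M) := rfl

theorem leftMul_monomial (i : ℕ) (c : F) :
    leftMul (Polynomial.monomial i c) = LinearMap.mulLeft ℤ (Polynomial.C c) * deltaMul ^ i := by
  unfold leftMul
  apply Polynomial.sum_monomial_index
  ext q : 1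
  simp

theorem leftMul_add (p q : Polynomial F) : leftMul (p + q) = leftMul p + leftMul q := by
  unfold leftMul
  apply Polynomial.sum_add_index
  · intro i
    ext q : 1
    simp
  · intro i a b
    ext q : 1
    simp [add_mul]

theorem leftMul_zero : leftMul (0 : Polynomial F) = 0 := by
  simp [leftMul]

theorem leftMul_deltaMul (p : Polynomial F) : leftMul (deltaMul p) = deltaMul * leftMul p := by
  induction p using Polynomial.induction_on' with
  | add p q hp hq => rw [map_add, leftMul_add, leftMul_add, hp, hq, mul_add]
  | monomial i c =>
    rw [deltaMul_apply, Polynomial.X_mul_monomial, mapCoeffs_monomial, leftMul_add,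
      leftMul_monomial, leftMul_monomial, leftMul_monomial]
    ext q : 1
    simp only [Module.End.mul_apply, LinearMap.add_apply, LinearMap.mulLeft_apply,
      pow_succ', deltaMul_apply, Derivation.leibniz, mapCoeffs_C, smul_eq_mul]
    ring

theorem leftMul_deltaMul_pow (i : ℕ) (p : Polynomial F) :
    leftMul ((deltaMul ^ i : Module.End ℤ _) p) = deltaMul ^ i * leftMul p := by
  induction i with
  | zero => simp
  | succ i ih =>
    rw [pow_succ', Module.End.mul_apply, leftMul_deltaMul, ih, mul_assoc]

theorem leftMul_C_mul (c : F) (p : Polynomial F) :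
    leftMul (Polynomial.C c * p) = LinearMap.mulLeft ℤ (Polynomial.C c) * leftMul p := by
  induction p using Polynomial.induction_on' with
  | add p q hp hq => rw [mul_add, leftMul_add, leftMul_add, hp, hq, mul_add]
  | monomial i b =>
    rw [Polynomial.C_mul_monomial, leftMul_monomial, leftMul_monomial]
    ext q : 1
    simp

theorem leftMul_leftMul (p q : Polynomial F) :
    leftMul (leftMul p q) = leftMul p * leftMul q := by
  induction p using Polynomial.induction_on' with
  | add p r hp hr => rw [leftMul_add, LinearMap.add_apply, leftMul_add, hp, hr, add_mul]
  | monomial i b =>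
    rw [leftMul_monomial, Module.End.mul_apply, LinearMap.mulLeft_apply, leftMul_C_mul,
      leftMul_deltaMul_pow, mul_assoc]

theorem deltaMul_pow_one (i : ℕ) :
    (deltaMul ^ i : Module.End ℤ _) (1 : Polynomial F) = Polynomial.X ^ i := by
  induction i with
  | zero => simp
  | succ i ih =>
    rw [pow_succ', Module.End.mul_apply, ih, deltaMul_apply, Polynomial.X_pow_eq_monomial,
      mapCoeffs_monomial, Polynomial.X_mul_monomial]
    simp [Polynomial.X_pow_eq_monomial]

theorem leftMul_apply_one (p : Polynomial F) : leftMul p 1 = p := by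
  induction p using Polynomial.induction_on' with
  | add p r hp hr => rw [leftMul_add, LinearMap.add_apply, hp, hr]
  | monomial i b =>
    rw [leftMul_monomial, Module.End.mul_apply, deltaMul_pow_one]
    simp [Polynomial.C_mul_X_pow_eq_monomial]

theorem leftMul_one : leftMul (1 : Polynomial F) = 1 := by
  rw [← Polynomial.C_1, ← Polynomial.monomial_zero_left, leftMul_monomial]
  ext q : 1
  simp

/-- The Ore ring `F[δ]`. -/
instance : Ring (DiffOp F) where
  __ := (inferInstance : AddCommGroup (DiffOp F))
  left_distrib L M N := (leftMul (toPoly L)).map_add (toPoly M) (toPoly N)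
  right_distrib L M N := DFunLike.congr_fun (leftMul_add (toPoly L) (toPoly M)) (toPoly N)
  zero_mul L := DFunLike.congr_fun leftMul_zero (toPoly L)
  mul_zero L := (leftMul (toPoly L)).map_zero
  mul_assoc L M N := DFunLike.congr_fun (leftMul_leftMul (toPoly L) (toPoly M)) (toPoly N)
  one_mul L := DFunLike.congr_fun leftMul_one (toPoly L)
  mul_one L := leftMul_apply_one (toPoly L)

/-- The commutation rule of the Ore ring. -/
theorem delta_mul_ofField (c : F) :
    (delta : DiffOp F) * ofField c = ofField c * delta + ofField c′ := by
  apply toPoly.injective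
  rw [map_add, toPoly_mul, toPoly_mul]
  change leftMul Polynomial.X (Polynomial.C c) =
    leftMul (Polynomial.C c) Polynomial.X + Polynomial.C c′
  have h1 : leftMul (Polynomial.X : Polynomial F) = deltaMul := by
    rw [← Polynomial.monomial_one_one_eq_X, leftMul_monomial]
    ext q : 1
    simp
  have h2 : leftMul (Polynomial.C c) = LinearMap.mulLeft ℤ (Polynomial.C c) := by
    rw [← Polynomial.monomial_zero_left, leftMul_monomial]
    simp
  rw [h1, h2, LinearMap.mulLeft_apply, deltaMul_apply, mapCoeffs_C, mul_comm]

end Mul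

/-! ### Left divisors and the extended left Euclidean algorithm

In a noncommutative ring, Mathlib's `D ∣ L` means `∃ Q, L = D * Q`, that is, `D` is a left divisor
of `L`. -/

section Euclid

variable {F : Type*} [Field F] [Differential F]

/-- `G` is the greatest common left divisor `gcld(L₁, L₂)`: a common left divisor of the highest
degree, normalized to be monic. -/
structure IsGCLD (L₁ L₂ G : DiffOp F) : Prop where
  monic : G.Monic
  dvd_left : G ∣ L₁
  dvd_right : G ∣ L₂
  degree_le : ∀ D : DiffOp F, D ∣ L₁ → D ∣ L₂ → D.degree ≤ G.degree

theorem deltaMul_degree {q : Polynomial F} {k : ℕ} (hq : q.natDegree ≤ k) :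
    (deltaMul q).natDegree ≤ k + 1 ∧ (deltaMul q).coeff (k + 1) = q.coeff k := by
  have h : ∀ j, k < j → q.coeff j = 0 := fun j hj =>
    Polynomial.coeff_eq_zero_of_natDegree_lt (by omega)
  constructor
  · rw [Polynomial.natDegree_le_iff_coeff_eq_zero]
    intro j hj
    obtain ⟨j, rfl⟩ : ∃ i, j = i + 1 := ⟨j - 1, by omega⟩
    rw [deltaMul_apply, Polynomial.coeff_add, Polynomial.coeff_X_mul, coeff_mapCoeffs,
      h j (by omega), h (j + 1) (by omega)]
    simp
  · rw [deltaMul_apply, Polynomial.coeff_add, Polynomial.coeff_X_mul, coeff_mapCoeffs,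
      h (k + 1) (by omega)]
    simp

theorem deltaMul_pow_degree {q : Polynomial F} {k : ℕ} (hq : q.natDegree ≤ k) (i : ℕ) :
    ((deltaMul ^ i : Module.End ℤ _) q).natDegree ≤ k + i ∧
      ((deltaMul ^ i : Module.End ℤ _) q).coeff (k + i) = q.coeff k := by
  induction i with
  | zero => simpa using hq
  | succ i ih =>
    have := deltaMul_degree ih.1
    rw [pow_succ', Module.End.mul_apply, ← add_assoc]
    exact ⟨this.1, this.2.trans ih.2⟩

theorem leftMul_degree {p q : Polynomial F} {n k : ℕ} (hp : p.natDegree ≤ n)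
    (hq : q.natDegree ≤ k) :
    (leftMul p q).natDegree ≤ n + k ∧ (leftMul p q).coeff (n + k) = p.coeff n * q.coeff k := by
  have key : leftMul p q = ∑ i ∈ Finset.range (n + 1),
      Polynomial.C (p.coeff i) * (deltaMul ^ i : Module.End ℤ _) q := by
    conv_lhs => rw [p.as_sum_range_C_mul_X_pow' (Nat.lt_succ_of_le hp)]
    have : ∀ s : Finset ℕ, leftMul (∑ i ∈ s, Polynomial.C (p.coeff i) * Polynomial.X ^ i) q =
        ∑ i ∈ s, Polynomial.C (p.coeff i) * (deltaMul ^ i : Module.End ℤ _) q := by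
      intro s
      induction s using Finset.induction_on with
      | empty => simp [leftMul_zero]
      | insert i s hi ih =>
        rw [Finset.sum_insert hi, Finset.sum_insert hi, leftMul_add, LinearMap.add_apply, ih,
          Polynomial.C_mul_X_pow_eq_monomial, leftMul_monomial]
        rfl
    exact this _
  have hz : ∀ i, i < n → ∀ j, n + k ≤ j →
      ((deltaMul ^ i : Module.End ℤ _) q).coeff j = 0 := fun i hi j hj =>
    Polynomial.coeff_eq_zero_of_natDegree_lt
      (lt_of_le_of_lt (deltaMul_pow_degree hq i).1 (by omega))
  constructor
  · rw [Polynomial.natDegree_le_iff_coeff_eq_zero]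
    intro j hj
    rw [key, Polynomial.finsetSum_coeff]
    apply Finset.sum_eq_zero
    intro i hi
    have hi' := Finset.mem_range.1 hi
    rw [Polynomial.coeff_C_mul, Polynomial.coeff_eq_zero_of_natDegree_lt
      (lt_of_le_of_lt (deltaMul_pow_degree hq i).1 (by omega)), mul_zero]
  · rw [key, Polynomial.finsetSum_coeff, Finset.sum_range_succ, Finset.sum_eq_zero, zero_add,
      Polynomial.coeff_C_mul, add_comm n k, (deltaMul_pow_degree hq n).2]
    intro i hi
    rw [Polynomial.coeff_C_mul, hz i (Finset.mem_range.1 hi) _ le_rfl, mul_zero]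

/-- Left Euclidean division in `F[δ]`. -/
theorem exists_left_division (L₁ L₂ : DiffOp F) (h : L₂ ≠ 0) :
    ∃ Q : DiffOp F, (L₁ - L₂ * Q).degree < L₂.degree := by
  have h' : toPoly L₂ ≠ 0 := fun e => h (toPoly.injective (by rw [e, map_zero]))
  suffices H : ∀ n : ℕ, ∀ L₁ : DiffOp F, (toPoly L₁).natDegree ≤ n →
      ∃ Q : DiffOp F, (L₁ - L₂ * Q).degree < L₂.degree from H _ L₁ le_rfl
  intro n
  induction n using Nat.strong_induction_on with
  | _ n ih =>
    intro L₁ hn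
    by_cases hlt : L₁.degree < L₂.degree
    · exact ⟨0, by simpa using hlt⟩
    · have hle : (toPoly L₂).natDegree ≤ (toPoly L₁).natDegree :=
        Polynomial.natDegree_le_natDegree (not_lt.1 hlt)
      set m := (toPoly L₂).natDegree with hm
      set k := (toPoly L₁).natDegree with hk
      set c : F := ((toPoly L₂).coeff m)⁻¹ * (toPoly L₁).coeff k with hc
      have hb : (toPoly L₂).coeff m ≠ 0 := by
        rw [hm]
        exact Polynomial.leadingCoeff_ne_zero.2 h'
      let M : DiffOp F := toPoly.symm (Polynomial.monomial (k - m) c)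
      have hM : toPoly M = Polynomial.monomial (k - m) c := rfl
      have hd := leftMul_degree (p := toPoly L₂) (q := toPoly M) (n := m) (k := k - m) hm.symm.le
        (by rw [hM]; exact Polynomial.natDegree_monomial_le _)
      rw [← toPoly_mul, Nat.add_sub_cancel' hle, hM, Polynomial.coeff_monomial, if_pos rfl, hc,
        mul_inv_cancel_left₀ hb] at hd
      have hd1 : (toPoly (L₁ - L₂ * M)).natDegree ≤ k := by
        rw [map_sub]
        exact (Polynomial.natDegree_sub_le _ _).trans (max_le le_rfl hd.1)
      have hd2 : (toPoly (L₁ - L₂ * M)).coeff k = 0 := by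
        rw [map_sub, Polynomial.coeff_sub, hd.2, sub_self]
      rcases Nat.eq_zero_or_pos k with h0 | hpos
      · refine ⟨M, ?_⟩
        have : toPoly (L₁ - L₂ * M) = 0 := by
          rw [h0] at hd1 hd2
          rw [Polynomial.eq_C_of_natDegree_le_zero hd1, hd2, Polynomial.C_0]
        unfold degree
        rw [this, Polynomial.degree_zero]
        exact bot_lt_iff_ne_bot.2 (fun e => h' (Polynomial.degree_eq_bot.1 e))
      · have hlt' : (toPoly (L₁ - L₂ * M)).natDegree < k := by
          rcases hd1.lt_or_eq with h1 | h1
          · exact h1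
          · have h2 := hd2
            rw [← h1] at h2
            have h3 := Polynomial.leadingCoeff_eq_zero.1 h2
            rw [h3, Polynomial.natDegree_zero]
            exact hpos
        obtain ⟨Q, hQ⟩ := ih _ (lt_of_lt_of_le hlt' hn) (L₁ - L₂ * M) le_rfl
        refine ⟨M + Q, ?_⟩
        rwa [mul_add, ← sub_sub]

open Classical in
/-- The left quotient of `L₁` with respect to `L₂ ≠ 0`: the operator `Q` with
`L₁ = L₂ * Q + R` and `deg R < deg L₂`. -/
def lquo (L₁ L₂ : DiffOp F) : DiffOp F :=
  if h : L₂ = 0 then 0 else (exists_left_division L₁ L₂ h).choose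

/-- The left remainder `R` in `L₁ = L₂ * Q + R`. -/
def lrem (L₁ L₂ : DiffOp F) : DiffOp F := L₁ - L₂ * lquo L₁ L₂

theorem degree_lrem_lt (L₁ : DiffOp F) {L₂ : DiffOp F} (h : L₂ ≠ 0) :
    (lrem L₁ L₂).degree < L₂.degree := by
  rw [lrem, lquo, dif_neg h]
  exact (exists_left_division L₁ L₂ h).choose_spec

theorem mul_lquo_add_lrem (L₁ L₂ : DiffOp F) : L₂ * lquo L₁ L₂ + lrem L₁ L₂ = L₁ := by
  rw [lrem]
  abel

/-- The output `(R_{n-1}, A_n, B_n, A_{n-1}, B_{n-1})` of the extended left Euclidean algorithm. -/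
structure ELEOutput (F : Type*) [Field F] where
  /-- the last nonzero remainder `R_{n-1}` -/
  R : DiffOp F
  /-- the cofactor `A_n` -/
  A : DiffOp F
  /-- the cofactor `B_n` -/
  B : DiffOp F
  /-- the cofactor `A_{n-1}` -/
  A' : DiffOp F
  /-- the cofactor `B_{n-1}` -/
  B' : DiffOp F

open Classical in
/-- The loop of the extended left Euclidean algorithm, entered with the values
`R_{i-1}, A_{i-1}, B_{i-1}, R_i, A_i, B_i`. -/
def eleLoop (R' A' B' R A B : DiffOp F) : ELEOutput F :=
  if R = 0 then ⟨R', A, B, A', B'⟩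
  else eleLoop R A B (lrem R' R) (A' - A * lquo R' R) (B' - B * lquo R' R)
termination_by R.degree
decreasing_by exact degree_lrem_lt _ ‹_›

/-- The extended left Euclidean algorithm. -/
def ele (L₁ L₂ : DiffOp F) : ELEOutput F := eleLoop L₁ 1 0 L₂ 0 1

end Euclid

end DiffOp

/-! ### Differential polynomials -/

/-- The underlying ring of the differential polynomial ring `F{y_j : j ∈ σ}`: the variable
`(j, k)` is the derivative `y_j^(k)`. -/
abbrev DiffPoly (σ : Type*) (F : Type*) [CommRing F] := MvPolynomial (σ × ℕ) F

section DiffPoly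

variable {σ : Type*} {F : Type*} [CommRing F] [Differential F]

/-- Differentiate the coefficients of a polynomial. -/
def coeffDer (p : DiffPoly σ F) : DiffPoly σ F :=
  ∑ m ∈ p.support, MvPolynomial.monomial m (p.coeff m)′

theorem coeff_coeffDer (p : DiffPoly σ F) (m : σ × ℕ →₀ ℕ) :
    (coeffDer p).coeff m = (p.coeff m)′ := by
  classical
  unfold coeffDer
  rw [MvPolynomial.coeff_sum]
  simp only [MvPolynomial.coeff_monomial]
  rw [Finset.sum_ite_eq' p.support m]
  split_ifs with h
  · rfl
  · rw [MvPolynomial.notMem_support_iff.1 h, map_zero]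

theorem coeffDer_add (p q : DiffPoly σ F) : coeffDer (p + q) = coeffDer p + coeffDer q := by
  ext m
  simp [coeff_coeffDer]

theorem coeffDer_monomial (m : σ × ℕ →₀ ℕ) (c : F) :
    coeffDer (MvPolynomial.monomial m c) = MvPolynomial.monomial m c′ := by
  classical
  ext k
  rw [coeff_coeffDer, MvPolynomial.coeff_monomial, MvPolynomial.coeff_monomial]
  split_ifs <;> simp

theorem coeffDer_mul (p q : DiffPoly σ F) :
    coeffDer (p * q) = p * coeffDer q + q * coeffDer p := by
  induction p using MvPolynomial.induction_on' with
  | add p r hp hr => rw [add_mul, coeffDer_add, coeffDer_add, hp, hr]; ring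
  | monomial m c =>
    induction q using MvPolynomial.induction_on' with
    | add q r hq hr => rw [mul_add, coeffDer_add, coeffDer_add, hq, hr]; ring
    | monomial k b =>
      simp only [MvPolynomial.monomial_mul, coeffDer_monomial, Derivation.leibniz, smul_eq_mul,
        map_add]
      rw [add_comm k m]

/-- `coeffDer` as a derivation. -/
def coeffDerivation : Derivation ℤ (DiffPoly σ F) (DiffPoly σ F) :=
  Derivation.mk' (AddMonoidHom.mk' coeffDer coeffDer_add).toIntLinearMap
    (fun p q => coeffDer_mul p q)

/-- The differential polynomial ring: its derivation extends that of `F` and maps `y_j^(k)` to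
`y_j^(k+1)`. -/
instance : Differential (DiffPoly σ F) where
  deriv := coeffDerivation +
    (MvPolynomial.mkDerivation F fun v : σ × ℕ =>
      (MvPolynomial.X (v.1, v.2 + 1) : DiffPoly σ F)).restrictScalars ℤ

theorem deriv_X (j : σ) (k : ℕ) :
    (MvPolynomial.X (j, k) : DiffPoly σ F)′ = MvPolynomial.X (j, k + 1) := by
  change coeffDer (MvPolynomial.X (j, k)) + MvPolynomial.mkDerivation F _ _ = _
  rw [MvPolynomial.mkDerivation_X, MvPolynomial.X, coeffDer_monomial]
  simp

instance : DifferentialAlgebra F (DiffPoly σ F) where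
  deriv_algebraMap c := by
    change coeffDer (MvPolynomial.C c) + MvPolynomial.mkDerivation F _ (algebraMap F _ c) = _
    rw [Derivation.map_algebraMap, MvPolynomial.C_apply, coeffDer_monomial]
    simp [MvPolynomial.algebraMap_eq]

/-- The linear differential polynomial `L₁(x) + L₂(y) + a` in `F{x, y}`. -/
def linearDiffPoly (L₁ L₂ : DiffOp F) (a : F) : DiffPoly (Fin 2) F :=
  L₁.apply (MvPolynomial.X (0, 0)) + L₂.apply (MvPolynomial.X (1, 0)) + MvPolynomial.C a

/-- A differential ideal: an ideal closed under the derivation. -/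
def IsDiffIdeal (I : Ideal (DiffPoly σ F)) : Prop := ∀ f ∈ I, f′ ∈ I

/-- The differential ideal `[S]` generated by `S`. -/
def diffSpan (S : Set (DiffPoly σ F)) : Ideal (DiffPoly σ F) :=
  Ideal.span {g | ∃ f ∈ S, ∃ k : ℕ, g = der k f}

end DiffPoly

/-! ### Rankings and the saturation ideal -/

/-- A ranking on the derivatives `y_j^(k)`. -/
structure Ranking (σ : Type*) where
  /-- the total order -/
  order : LinearOrder (σ × ℕ)
  lt_der : ∀ v : σ × ℕ, order.lt v (v.1, v.2 + 1)
  der_lt_der : ∀ v w : σ × ℕ, order.lt v w → order.lt (v.1, v.2 + 1) (w.1, w.2 + 1)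

section Saturation

variable {σ : Type*} {F : Type*} [CommRing F]

/-- The leader of a differential polynomial in which some derivative `y_j^(k)` appears. -/
def leader (R : Ranking σ) (A : DiffPoly σ F) (h : A.vars.Nonempty) : σ × ℕ :=
  @Finset.max' _ R.order A.vars h

/-- The coefficient of the highest power of the variable `v` in `A`, with `A` viewed as a
univariate polynomial in `v`. -/
def leadingCoeffIn (v : σ × ℕ) (A : DiffPoly σ F) : DiffPoly σ F :=
  ∑ m ∈ A.support with m v = A.degreeOf v, MvPolynomial.monomial (m.erase v) (A.coeff m)

open Classical in
/-- The product of the separant and the initial of `A` (and `1` when `A` is a constant). -/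
def sepInit (R : Ranking σ) (A : DiffPoly σ F) : DiffPoly σ F :=
  if h : A.vars.Nonempty then
    MvPolynomial.pderiv (leader R A h) A * leadingCoeffIn (leader R A h) A
  else 1

/-- The saturation ideal `sat(A) = [A] : (S_A I_A)^∞`. For irreducible `A` this is the general
component of `A`, the ideal of the differential curve `(𝒞, A)`, `𝒞 = 𝕍(sat(A))`. -/
def sat [Differential F] (R : Ranking σ) (A : DiffPoly σ F) : Ideal (DiffPoly σ F) where
  carrier := {f | ∃ m : ℕ, sepInit R A ^ m * f ∈ diffSpan {A}}
  zero_mem' := ⟨0, by simp⟩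
  add_mem' := by
    rintro f g ⟨m, hm⟩ ⟨n, hn⟩
    refine ⟨m + n, ?_⟩
    have h1 := (diffSpan {A}).mul_mem_left (sepInit R A ^ n) hm
    have h2 := (diffSpan {A}).mul_mem_left (sepInit R A ^ m) hn
    convert (diffSpan {A}).add_mem h1 h2 using 1
    ring
  smul_mem' := by
    rintro c f ⟨m, hm⟩
    refine ⟨m, ?_⟩
    convert (diffSpan {A}).mul_mem_left c hm using 1
    rw [smul_eq_mul]
    ring

end Saturation

/-! ### Points in a differential extension field -/

section Points

variable {σ : Type*} (F : Type*) {E : Type*} [Field F] [Field E] [Differential E] [Algebra F E]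

/-- Evaluation `f ↦ f(η)` of differential polynomials over `F` at a point `η`. -/
def diffEval (η : σ → E) : DiffPoly σ F →ₐ[F] E :=
  MvPolynomial.aeval fun v : σ × ℕ => der v.2 (η v.1)

/-- The ideal `𝕀(η)` of all differential polynomials over `F` that vanish at `η`. -/
def vanishingIdeal (η : σ → E) : Ideal (DiffPoly σ F) := RingHom.ker (diffEval F η)

/-- `η` is a generic point of the ideal `P` (or of the variety `𝕍(P)`). Such a `P` is
automatically a prime ideal. -/
def IsGenericPoint (P : Ideal (DiffPoly σ F)) (η : σ → E) : Prop := vanishingIdeal F η = P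

/-- `u` is differentially transcendental over `F`. -/
def DiffTranscendental (u : E) : Prop := AlgebraicIndependent F fun k : ℕ => der k u

/-- The differential field `F⟨S⟩` generated by `S` over `F`. -/
def diffAdjoin (S : Set E) : IntermediateField F E :=
  IntermediateField.adjoin F {z | ∃ s ∈ S, ∃ k : ℕ, z = der k s}

/-- The differential field structure on an intermediate field that is closed under the
derivation. -/
@[reducible]
def subDifferential {F : Type*} {E : Type*} [Field F] [Field E] [Differential E] [Algebra F E]
    (G : IntermediateField F E) (hG : ∀ z ∈ G, z′ ∈ G) : Differential G where
  deriv := Derivation.mk'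
    (AddMonoidHom.mk' (fun z : G => (⟨(z : E)′, hG z z.2⟩ : G))
      (fun a b => Subtype.ext (by simp))).toIntLinearMap
    (fun a b => Subtype.ext (by simp))

variable (E) in
/-- `E` is a universal differential extension field of `F` (of characteristic zero): for every
differential field `G` with `F ⊆ G ⊆ E` that is finitely generated over `F` as a differential
field, and every `n`, each prime differential ideal of `G{y_1, …, y_n}` has a generic zero in
`E^n`. -/
def IsUniversalExtension : Prop :=
  ∀ (G : IntermediateField F E) (hG : ∀ z ∈ G, z′ ∈ G),
    (∃ S : Set E, S.Finite ∧ G = diffAdjoin F S) →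
    letI : Differential G := subDifferential G hG
    ∀ (n : ℕ) (P : Ideal (DiffPoly (Fin n) G)), P.IsPrime → IsDiffIdeal P →
      ∃ η : Fin n → E, IsGenericPoint G P η

end Points

/-! ### Differential rational parametrizations of plane differential curves -/

section Parametrization

variable {F : Type*} {E : Type*} [Field F] [Differential F] [Field E] [Differential E]
  [Algebra F E]

/-- `η = 𝒫(u)` is a differential rational parametrization, with differential parameter `u`, of the
differential curve `(𝒞, A)`: each coordinate is a quotient `P(u) / Q(u)` of coprime differential
polynomials in one differential indeterminate over `F`, and `η` is a generic point of the curve. -/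
structure IsRationalParametrization (R : Ranking (Fin 2)) (A : DiffPoly (Fin 2) F) (u : E)
    (η : Fin 2 → E) : Prop where
  parameter : DiffTranscendental F u
  rational : ∀ i, ∃ P Q : DiffPoly Unit F, Q ≠ 0 ∧ IsRelPrime P Q ∧
    η i = diffEval F (fun _ => u) P / diffEval F (fun _ => u) Q
  generic : IsGenericPoint F (sat R A) η

variable (E) in
/-- The differential curve `(𝒞, A)` (with `A` irreducible) is unirational. -/
def IsUnirational (R : Ranking (Fin 2)) (A : DiffPoly (Fin 2) F) : Prop :=
  Irreducible A ∧ ∃ (u : E) (η : Fin 2 → E), IsRationalParametrization R A u η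

/-- A proper differential parametrization of `(𝒞, A)` by linear differential polynomials in the
parameter `u`. -/
structure IsProperLinearPolyParametrization (R : Ranking (Fin 2)) (A : DiffPoly (Fin 2) F) (u : E)
    (η : Fin 2 → E) : Prop extends IsRationalParametrization R A u η where
  proper : diffAdjoin F (Set.range η) = diffAdjoin F {u}
  linear : ∀ i, ∃ P : DiffPoly Unit F, P.totalDegree ≤ 1 ∧ η i = diffEval F (fun _ => u) P
  nonconstant : ∃ i, η i ∉ Set.range (algebraMap F E)

/-- The point `(A_n(u) + A_{n-1}(-a/c), B_n(u) + B_{n-1}(-a/c))` formed from the output of the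
extended left Euclidean algorithm. -/
def eleParametrization (T : DiffOp.ELEOutput F) (a c : F) (u : E) : Fin 2 → E :=
  ![T.A.apply u + algebraMap F E (T.A'.apply (-a / c)),
    T.B.apply u + algebraMap F E (T.B'.apply (-a / c))]

end Parametrization

end DiffAlg

end

/-!
Over `F[δ]`, the Euclidean algorithm provides an invertible matrix `U` with
`(L₁, L₂) U = (g, 0)`, where `g` is a greatest common left divisor. If `g = c` is a nonzero element
of `F`, then in the coordinates `U⁻¹(x, y)` the curve is given by `c x + a = 0`, so that
`u ↦ U(-a/c, u)` is a generic point with polynomial inverse.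

Conversely, let `η` be a generic point over `F⟨u⟩` and `Lᵢ = D Mᵢ`. Then `w = M₁(η₀) + M₂(η₁)`
satisfies `D(w) = -a`. An element of `F⟨u⟩` outside `F` cannot satisfy a nontrivial linear equation
over `F`: if `u^(n)` is the highest derivative of `u` that it involves, then its derivatives involve
`u^(n+1)`, `u^(n+2)`, and so on. So `w` lies in `F`, and by genericity of `η` the polynomial
`M₁(x) + M₂(y) - w` lies in the differential ideal of `L₁(x) + L₂(y) + a`. The elements of degree
at most one of this ideal are the `N(L₁(x) + L₂(y) + a)` with `N` in `F[δ]`, whence `N D = 1`.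
-/

noncomputable section

namespace DiffAlg

open Differential

open scoped Matrix

section IteratedDerivatives

variable {K : Type*} [CommRing K] [Differential K]

theorem der_succ (k : ℕ) (z : K) : der (k + 1) z = (der k z)′ :=
  Function.iterate_succ_apply' _ _ _

theorem der_add (k : ℕ) (y z : K) : der k (y + z) = der k y + der k z :=
  iterate_map_add (Differential.deriv : Derivation ℤ K K) k y z

theorem der_sub (k : ℕ) (y z : K) : der k (y - z) = der k y - der k z :=
  iterate_map_sub (Differential.deriv : Derivation ℤ K K) k y z

theorem der_algebraMap {F : Type*} [CommRing F] [Differential F] [Algebra F K]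
    [DifferentialAlgebra F K] (k : ℕ) (c : F) :
    der k (algebraMap F K c) = algebraMap F K (der k c) := by
  induction k with
  | zero => rfl
  | succ k ih => rw [der_succ, der_succ, ih, deriv_algebraMap]

theorem der_X {σ F : Type*} [CommRing F] [Differential F] (k : ℕ) (j : σ) (l : ℕ) :
    der k (MvPolynomial.X (j, l) : DiffPoly σ F) = MvPolynomial.X (j, l + k) := by
  induction k with
  | zero => rfl
  | succ k ih => rw [der_succ, ih, deriv_X, add_assoc]

end IteratedDerivatives

namespace DiffOp

section Ring

variable {F : Type*} [CommRing F] [Differential F]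

theorem toPoly_ofField_mul (c : F) (L : DiffOp F) :
    toPoly (ofField c * L) = Polynomial.C c * toPoly L := by
  have h := DFunLike.congr_fun (leftMul_C_mul c 1) (toPoly L)
  rwa [mul_one, leftMul_one] at h

theorem toPoly_delta_mul (L : DiffOp F) : toPoly (delta * L) = deltaMul (toPoly L) := by
  have h := DFunLike.congr_fun (leftMul_deltaMul 1) (toPoly L)
  rwa [← pow_one deltaMul, deltaMul_pow_one, pow_one, pow_one, leftMul_one, mul_one] at h

theorem toPoly_delta_pow (i : ℕ) : toPoly (delta ^ i : DiffOp F) = Polynomial.X ^ i := by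
  rw [← deltaMul_pow_one]
  induction i with
  | zero => rfl
  | succ i ih => rw [pow_succ', toPoly_delta_mul, ih, pow_succ', Module.End.mul_apply]

theorem toPoly_ofField_mul_delta_pow (c : F) (i : ℕ) :
    toPoly (ofField c * delta ^ i) = Polynomial.monomial i c := by
  rw [toPoly_ofField_mul, toPoly_delta_pow, Polynomial.C_mul_X_pow_eq_monomial]

@[elab_as_elim]
theorem induction_on {motive : DiffOp F → Prop} (L : DiffOp F)
    (add : ∀ L M, motive L → motive M → motive (L + M))
    (ofField_mul_delta_pow : ∀ c i, motive (ofField c * delta ^ i)) : motive L :=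
  Polynomial.induction_on' (motive := motive) L add fun i c => by
    rw [← toPoly_ofField_mul_delta_pow]
    exact ofField_mul_delta_pow c i

theorem ofField_mul_ofField (b c : F) : ofField b * ofField c = ofField (b * c) :=
  toPoly.injective ((toPoly_ofField_mul b _).trans Polynomial.C_mul.symm)

instance : Module F (DiffOp F) := inferInstanceAs (Module F (Polynomial F))

theorem smul_eq_ofField_mul (c : F) (L : DiffOp F) : c • L = ofField c * L :=
  toPoly.injective ((Polynomial.smul_eq_C_mul c).trans (toPoly_ofField_mul c L).symm)

end Ring

section Apply

variable {F : Type*} [CommRing F] {K : Type*} [CommRing K] [Algebra F K] [Differential K]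

theorem apply_add (L M : DiffOp F) (z : K) : (L + M).apply z = L.apply z + M.apply z :=
  Polynomial.sum_add_index _ _ _ (fun i => by rw [map_zero, zero_mul])
    fun i b c => by rw [map_add, add_mul]

theorem zero_apply (z : K) : (0 : DiffOp F).apply z = 0 := Polynomial.sum_zero_index _

theorem ofField_apply (c : F) (z : K) : (ofField c).apply z = algebraMap F K c * z :=
  Polynomial.sum_C_index (by rw [map_zero, zero_mul])

theorem one_apply (z : K) : (1 : DiffOp F).apply z = z :=
  (ofField_apply 1 z).trans (by rw [map_one, one_mul])

theorem apply_map_add (L : DiffOp F) (y z : K) : L.apply (y + z) = L.apply y + L.apply z := by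
  simp only [apply, Polynomial.sum_def, der_add, mul_add, Finset.sum_add_distrib]

theorem apply_map_sub (L : DiffOp F) (y z : K) : L.apply (y - z) = L.apply y - L.apply z :=
  map_sub (AddMonoidHom.mk' L.apply (apply_map_add L)) y z

theorem sum_apply {ι : Type*} (s : Finset ι) (L : ι → DiffOp F) (z : K) :
    (∑ i ∈ s, L i).apply z = ∑ i ∈ s, (L i).apply z :=
  map_sum (AddMonoidHom.mk' (fun L : DiffOp F => L.apply z) fun L M => apply_add L M z) L s

theorem apply_sum {ι : Type*} (L : DiffOp F) (s : Finset ι) (z : ι → K) :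
    L.apply (∑ i ∈ s, z i) = ∑ i ∈ s, L.apply (z i) :=
  map_sum (AddMonoidHom.mk' L.apply (apply_map_add L)) z s

variable [Differential F]

theorem ofField_mul_delta_pow_apply (c : F) (i : ℕ) (z : K) :
    (ofField c * delta ^ i).apply z = algebraMap F K c * der i z := by
  rw [apply, toPoly_ofField_mul_delta_pow]
  exact Polynomial.sum_monomial_index _ _ (by rw [map_zero, zero_mul])

theorem delta_pow_apply (i : ℕ) (z : K) : (delta ^ i : DiffOp F).apply z = der i z := by
  have h := ofField_mul_delta_pow_apply (1 : F) i z
  rwa [map_one, one_mul, show ofField (1 : F) = 1 from rfl, one_mul] at h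

theorem ofField_mul_apply (c : F) (L : DiffOp F) (z : K) :
    (ofField c * L).apply z = algebraMap F K c * L.apply z := by
  induction L using induction_on with
  | add L M hL hM => rw [mul_add, apply_add, apply_add, hL, hM, mul_add]
  | ofField_mul_delta_pow b i =>
    rw [← mul_assoc, ofField_mul_ofField, ofField_mul_delta_pow_apply,
      ofField_mul_delta_pow_apply, map_mul, mul_assoc]

variable [DifferentialAlgebra F K]

theorem apply_algebraMap (L : DiffOp F) (c : F) :
    L.apply (algebraMap F K c) = algebraMap F K (L.apply c) := by
  simp only [apply, Polynomial.sum_def, der_algebraMap, map_sum, map_mul,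
    Algebra.algebraMap_self_apply]

theorem delta_mul_apply (L : DiffOp F) (z : K) : (delta * L).apply z = (L.apply z)′ := by
  induction L using induction_on with
  | add L M hL hM => rw [mul_add, apply_add, apply_add, hL, hM, map_add]
  | ofField_mul_delta_pow c i =>
    rw [← mul_assoc, delta_mul_ofField, add_mul, mul_assoc, ← pow_succ', apply_add,
      ofField_mul_delta_pow_apply, ofField_mul_delta_pow_apply, ofField_mul_delta_pow_apply,
      Derivation.leibniz, der_succ, deriv_algebraMap, smul_eq_mul, smul_eq_mul,
      mul_comm (der i z)]

theorem der_apply (k : ℕ) (L : DiffOp F) (z : K) :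
    der k (L.apply z) = (delta ^ k * L).apply z := by
  induction k with
  | zero => rw [pow_zero, one_mul]; rfl
  | succ k ih => rw [der_succ, ih, pow_succ', mul_assoc, delta_mul_apply]

theorem mul_apply (L M : DiffOp F) (z : K) : (L * M).apply z = L.apply (M.apply z) := by
  induction L using induction_on with
  | add L N hL hN => rw [add_mul, apply_add, apply_add, hL, hN]
  | ofField_mul_delta_pow c i =>
    rw [mul_assoc, ofField_mul_apply, ofField_mul_delta_pow_apply, der_apply]

end Apply

section Degree

variable {F : Type*} [Field F]

theorem degree_one : (1 : DiffOp F).degree = 0 := Polynomial.degree_one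

theorem ofField_zero : ofField (0 : F) = 0 := Polynomial.C_0

theorem exists_eq_ofField {L : DiffOp F} (h : L.degree ≤ 0) : ∃ c, L = ofField c :=
  ⟨_, toPoly.injective (Polynomial.eq_C_of_degree_le_zero h)⟩

variable [Differential F]

instance : Nontrivial (DiffOp F) := inferInstanceAs (Nontrivial (Polynomial F))

theorem coeff_mul_natDegree_add_natDegree (L M : DiffOp F) :
    (L * M).coeff ((toPoly L).natDegree + (toPoly M).natDegree) =
      (toPoly L).leadingCoeff * (toPoly M).leadingCoeff :=
  (leftMul_degree le_rfl le_rfl).2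

instance : NoZeroDivisors (DiffOp F) where
  eq_zero_or_eq_zero_of_mul_eq_zero {L M} h := by
    have h0 := coeff_mul_natDegree_add_natDegree L M
    rw [h, coeff, map_zero, Polynomial.coeff_zero, eq_comm, mul_eq_zero] at h0
    simpa only [Polynomial.leadingCoeff_eq_zero, EmbeddingLike.map_eq_zero_iff] using h0

theorem degree_mul (L M : DiffOp F) : (L * M).degree = L.degree + M.degree := by
  rcases eq_or_ne L 0 with rfl | hL
  · rw [zero_mul]
    exact (WithBot.bot_add _).symm
  rcases eq_or_ne M 0 with rfl | hM
  · rw [mul_zero]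
    exact (WithBot.add_bot _).symm
  rw [← EmbeddingLike.map_ne_zero_iff (f := toPoly)] at hL hM
  rw [degree, degree, degree, Polynomial.degree_eq_natDegree hL, Polynomial.degree_eq_natDegree hM,
    ← Nat.cast_add]
  refine Polynomial.degree_eq_of_le_of_coeff_ne_zero
    (Polynomial.degree_le_of_natDegree_le (leftMul_degree le_rfl le_rfl).1) ?_
  refine (coeff_mul_natDegree_add_natDegree L M).trans_ne ?_
  exact mul_ne_zero (Polynomial.leadingCoeff_ne_zero.2 hL) (Polynomial.leadingCoeff_ne_zero.2 hM)

theorem degree_eq_zero_of_isUnit {L : DiffOp F} (h : IsUnit L) : L.degree = 0 := by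
  obtain ⟨M, hM⟩ := h.exists_right_inv
  have := congrArg degree hM
  rw [degree_mul, degree_one, Nat.WithBot.add_eq_zero_iff] at this
  exact this.1

end Degree

end DiffOp

section Substitution

variable {σ τ F : Type*} [CommRing F]

/-- The differential substitution `f ↦ f(η)` of a tuple `η` of elements of a differential
`F`-algebra; over a field this is `diffEval`. -/
def diffAeval {K : Type*} [CommRing K] [Differential K] [Algebra F K] (η : σ → K) :
    DiffPoly σ F →ₐ[F] K :=
  MvPolynomial.aeval fun v : σ × ℕ => der v.2 (η v.1)

section

variable {K : Type*} [CommRing K] [Differential K] [Algebra F K] (η : σ → K)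

theorem diffAeval_X (j : σ) (k : ℕ) :
    diffAeval η (MvPolynomial.X (j, k) : DiffPoly σ F) = der k (η j) :=
  MvPolynomial.aeval_X _ _

variable [Differential F] [DifferentialAlgebra F K]

theorem diffAeval_deriv (f : DiffPoly σ F) : diffAeval η f′ = (diffAeval η f)′ := by
  induction f using MvPolynomial.induction_on with
  | C c =>
    rw [← MvPolynomial.algebraMap_eq, deriv_algebraMap, AlgHom.commutes, AlgHom.commutes,
      deriv_algebraMap]
  | add f g hf hg => rw [map_add, map_add, hf, hg, map_add, map_add]
  | mul_X f v hf =>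
    rw [Derivation.leibniz, deriv_X, smul_eq_mul, smul_eq_mul, map_add, map_mul, map_mul, map_mul,
      hf, diffAeval_X, diffAeval_X, Derivation.leibniz, smul_eq_mul, smul_eq_mul, der_succ]

theorem diffAeval_der (k : ℕ) (f : DiffPoly σ F) :
    diffAeval η (der k f) = der k (diffAeval η f) := by
  induction k with
  | zero => rfl
  | succ k ih => rw [der_succ, der_succ, diffAeval_deriv, ih]

theorem diffAeval_apply (L : DiffOp F) (f : DiffPoly σ F) :
    diffAeval η (L.apply f) = L.apply (diffAeval η f) := by
  simp only [DiffOp.apply, Polynomial.sum_def, map_sum, map_mul, AlgHom.commutes, diffAeval_der]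

theorem diffAeval_linearDiffPoly (η : Fin 2 → K) (L₁ L₂ : DiffOp F) (a : F) :
    diffAeval η (linearDiffPoly L₁ L₂ a) =
      L₁.apply (η 0) + L₂.apply (η 1) + algebraMap F K a := by
  rw [linearDiffPoly, map_add, map_add, diffAeval_apply, diffAeval_apply, diffAeval_X, diffAeval_X,
    ← MvPolynomial.algebraMap_eq, AlgHom.commutes]
  rfl

theorem diffAeval_diffAeval (ξ : τ → DiffPoly σ F) (f : DiffPoly τ F) :
    diffAeval η (diffAeval ξ f) = diffAeval (fun j => diffAeval η (ξ j)) f := by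
  refine DFunLike.congr_fun (f := (diffAeval η).comp (diffAeval ξ)) ?_ f
  refine MvPolynomial.algHom_ext fun v => ?_
  rw [AlgHom.comp_apply, diffAeval_X, diffAeval_X, diffAeval_der]

end

variable [Differential F]

theorem diffAeval_X_zero (f : DiffPoly σ F) :
    diffAeval (fun j => (MvPolynomial.X (j, 0) : DiffPoly σ F)) f = f := by
  refine DFunLike.congr_fun (g := AlgHom.id F _) (MvPolynomial.algHom_ext fun v => ?_) f
  rw [diffAeval_X, der_X, zero_add, AlgHom.id_apply]

end Substitution

section DifferentialIdeals

variable {σ τ F : Type*} [CommRing F] [Differential F] {I : Ideal (DiffPoly σ F)}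

theorem IsDiffIdeal.der_mem (hI : IsDiffIdeal I) (k : ℕ) {f : DiffPoly σ F} (hf : f ∈ I) :
    der k f ∈ I := by
  induction k with
  | zero => exact hf
  | succ k ih => exact der_succ k f ▸ hI _ ih

theorem IsDiffIdeal.diffAeval_sub_diffAeval_mem (hI : IsDiffIdeal I) {ξ ζ : τ → DiffPoly σ F}
    (h : ∀ j, ξ j - ζ j ∈ I) (f : DiffPoly τ F) : diffAeval ξ f - diffAeval ζ f ∈ I := by
  rw [← Ideal.Quotient.mk_eq_mk_iff_sub_mem]
  refine DFunLike.congr_fun (f := (Ideal.Quotient.mkₐ F I).comp (diffAeval ξ))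
    (g := (Ideal.Quotient.mkₐ F I).comp (diffAeval ζ)) (MvPolynomial.algHom_ext fun v => ?_) f
  rw [AlgHom.comp_apply, AlgHom.comp_apply, diffAeval_X, diffAeval_X, Ideal.Quotient.mkₐ_eq_mk,
    Ideal.Quotient.mk_eq_mk_iff_sub_mem, ← der_sub]
  exact hI.der_mem _ (h _)

theorem IsDiffIdeal.apply_mem (hI : IsDiffIdeal I) (L : DiffOp F) {f : DiffPoly σ F} (hf : f ∈ I) :
    L.apply f ∈ I :=
  Ideal.sum_mem _ fun _ _ => Ideal.mul_mem_left _ _ (hI.der_mem _ hf)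

theorem subset_diffSpan (S : Set (DiffPoly σ F)) : S ⊆ diffSpan S :=
  fun f hf => Ideal.subset_span ⟨f, hf, 0, rfl⟩

theorem isDiffIdeal_diffSpan (S : Set (DiffPoly σ F)) : IsDiffIdeal (diffSpan S) := by
  intro f hf
  induction hf using Submodule.span_induction with
  | mem _ h =>
    obtain ⟨g, hg, k, rfl⟩ := h
    exact Ideal.subset_span ⟨g, hg, k + 1, (der_succ k g).symm⟩
  | zero =>
    rw [map_zero]
    exact zero_mem _
  | add f g _ _ hf hg =>
    rw [map_add]
    exact add_mem hf hg
  | smul c f hf ih =>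
    rw [smul_eq_mul, Derivation.leibniz, smul_eq_mul, smul_eq_mul]
    exact add_mem (Ideal.mul_mem_left _ _ ih) (Ideal.mul_mem_right _ _ hf)

theorem IsDiffIdeal.diffSpan_le (hI : IsDiffIdeal I) {S : Set (DiffPoly σ F)} (hS : S ⊆ I) :
    diffSpan S ≤ I :=
  Ideal.span_le.2 fun _ ⟨_, hf, k, h⟩ => h ▸ hI.der_mem k (hS hf)

theorem isDiffIdeal_vanishingIdeal {F E : Type*} [Field F] [Differential F] [Field E]
    [Differential E] [Algebra F E] [DifferentialAlgebra F E] (η : σ → E) :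
    IsDiffIdeal (vanishingIdeal F η) := fun f hf => by
  have h : diffAeval η f = 0 := hf
  exact (diffAeval_deriv η f).trans (by rw [h, map_zero])

end DifferentialIdeals

section DegreeOne

theorem eq_single_of_mem_support {τ F : Type*} [CommSemiring F] {A : MvPolynomial τ F}
    (hA : A.totalDegree ≤ 1) {m : τ →₀ ℕ} (hm : m ∈ A.support) {v : τ} (hv : m v ≠ 0) :
    m = Finsupp.single v 1 := by
  obtain ⟨d, rfl⟩ := exists_add_of_le (Finsupp.single_le_iff.2 (Nat.one_le_iff_ne_zero.2 hv))
  have h : (Finsupp.single v 1 + d).degree ≤ 1 := by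
    rw [Finsupp.degree_apply]
    exact (MvPolynomial.le_totalDegree hm).trans hA
  rw [map_add, Finsupp.degree_single] at h
  rw [(Finsupp.degree_eq_zero_iff d).1 (by lia), add_zero]

theorem degreeOf_eq_one_of_totalDegree_le_one {τ F : Type*} [CommSemiring F] {A : MvPolynomial τ F}
    (hA : A.totalDegree ≤ 1) {v : τ} (hv : v ∈ A.vars) : A.degreeOf v = 1 :=
  le_antisymm ((MvPolynomial.degreeOf_le_totalDegree A v).trans hA)
    (Nat.one_le_iff_ne_zero.2 (MvPolynomial.mem_vars_iff_degreeOf_ne_zero.1 hv))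

theorem pderiv_eq_C_of_totalDegree_le_one {τ F : Type*} [CommSemiring F] {A : MvPolynomial τ F}
    (hA : A.totalDegree ≤ 1) (v : τ) :
    MvPolynomial.pderiv v A = MvPolynomial.C (A.coeff (Finsupp.single v 1)) := by
  classical
  ext m
  rw [MvPolynomial.coeff_pderiv, MvPolynomial.coeff_C]
  split_ifs with hm
  · simp [← hm]
  · rw [MvPolynomial.notMem_support_iff.1, zero_mul]
    refine fun h => hm (add_right_cancel (b := Finsupp.single v 1) ?_)
    rw [eq_single_of_mem_support hA h (v := v) (by simp), zero_add]

variable {σ : Type*}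

theorem leadingCoeffIn_eq_C_of_totalDegree_le_one {F : Type*} [CommRing F] {A : DiffPoly σ F}
    (hA : A.totalDegree ≤ 1) {v : σ × ℕ} (hv : v ∈ A.vars) :
    leadingCoeffIn v A = MvPolynomial.C (A.coeff (Finsupp.single v 1)) := by
  rw [leadingCoeffIn, degreeOf_eq_one_of_totalDegree_le_one hA hv,
    Finset.sum_eq_single (Finsupp.single v 1)]
  · rw [Finsupp.erase_single]
    rfl
  · intro m hm hne
    rw [Finset.mem_filter] at hm
    exact absurd (eq_single_of_mem_support hA hm.1 (hm.2.trans_ne one_ne_zero)) hne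
  · intro h
    rw [Finset.mem_filter, Finsupp.single_eq_same, and_iff_left rfl,
      MvPolynomial.notMem_support_iff] at h
    rw [h, map_zero]

theorem isUnit_sepInit {F : Type*} [Field F] (R : Ranking σ) {A : DiffPoly σ F}
    (hA : A.totalDegree ≤ 1) : IsUnit (sepInit R A) := by
  rw [sepInit]
  split_ifs with h
  · have hv : leader R A h ∈ A.vars := @Finset.max'_mem _ R.order A.vars h
    obtain ⟨m, hm, hmv⟩ := (MvPolynomial.mem_vars_iff_mem_support _).1 hv
    rw [eq_single_of_mem_support hA hm (Finsupp.mem_support_iff.1 hmv)] at hm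
    have hc : IsUnit (MvPolynomial.C (A.coeff (Finsupp.single (leader R A h) 1)) : DiffPoly σ F) :=
      (MvPolynomial.mem_support_iff.1 hm).isUnit.map _
    rw [pderiv_eq_C_of_totalDegree_le_one hA, leadingCoeffIn_eq_C_of_totalDegree_le_one hA hv]
    exact hc.mul hc
  · exact isUnit_one

theorem sat_eq_diffSpan {F : Type*} [Field F] [Differential F] (R : Ranking σ) {A : DiffPoly σ F}
    (hA : A.totalDegree ≤ 1) : sat R A = diffSpan {A} := by
  refine le_antisymm ?_ fun f hf => ⟨0, by rwa [pow_zero, one_mul]⟩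
  rintro f ⟨m, hm⟩
  exact (Ideal.unit_mul_mem_iff_mem _ ((isUnit_sepInit R hA).pow m)).1 hm

theorem irreducible_of_totalDegree_le_one {τ F : Type*} [Field F] {A : MvPolynomial τ F}
    (hA : A.totalDegree ≤ 1) (h : ∀ c, A ≠ MvPolynomial.C c) : Irreducible A := by
  have h0 : A.totalDegree ≠ 0 := fun h0 => h _ (MvPolynomial.totalDegree_eq_zero_iff_eq_C.1 h0)
  refine MvPolynomial.irreducible_of_totalDegree_eq_one (by lia) fun x hx => Ne.isUnit ?_
  rintro rfl
  exact h 0 (by ext m; simpa using hx m)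

variable {F : Type*} [CommRing F] [Differential F]

theorem totalDegree_apply_X_le (L : DiffOp F) (j : σ) :
    (L.apply (MvPolynomial.X (j, 0) : DiffPoly σ F)).totalDegree ≤ 1 := by
  refine MvPolynomial.totalDegree_finsetSum_le fun i _ => ?_
  beta_reduce
  rw [der_X, MvPolynomial.algebraMap_eq, MvPolynomial.X, MvPolynomial.C_mul_monomial]
  exact (MvPolynomial.totalDegree_monomial_le _ _).trans (by simp)

theorem totalDegree_linearDiffPoly_le (L₁ L₂ : DiffOp F) (a : F) :
    (linearDiffPoly L₁ L₂ a).totalDegree ≤ 1 := by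
  refine (MvPolynomial.totalDegree_add _ _).trans (max_le
    ((MvPolynomial.totalDegree_add _ _).trans (max_le ?_ ?_)) ?_)
  · exact totalDegree_apply_X_le _ _
  · exact totalDegree_apply_X_le _ _
  · simp

end DegreeOne

section LinearMembers

theorem exists_linearMap_eq_one_ne_zero {K V : Type*} [Field K] [AddCommGroup V] [Module K V]
    {W : Submodule K V} {e v : V} (he : e ∉ W) (hv : v ∉ W) :
    ∃ f : V →ₗ[K] K, W ≤ LinearMap.ker f ∧ f e = 1 ∧ f v ≠ 0 := by
  obtain ⟨g, hg, hge⟩ := LinearMap.exists_extend_of_notMem (0 : W →ₗ[K] K) he 1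
  have hgW : W ≤ LinearMap.ker g := fun w hw =>
    LinearMap.mem_ker.2 (DFunLike.congr_fun hg ⟨w, hw⟩)
  by_cases hgv : g v = 0
  · obtain ⟨h, hhv, hhW⟩ := Submodule.exists_le_ker_of_notMem hv
    refine ⟨g + h - h e • g, fun w hw => ?_, ?_, ?_⟩
    · have h1 : g w = 0 := hgW hw
      have h2 : h w = 0 := hhW hw
      simp [h1, h2]
    · simp [hge]
    · simpa [hgv] using hhv
  · exact ⟨g, hgW, hge, hgv⟩

variable {F : Type*}

theorem apply_linearDiffPoly [CommRing F] [Differential F] (N L₁ L₂ : DiffOp F) (a : F) :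
    N.apply (linearDiffPoly L₁ L₂ a) = linearDiffPoly (N * L₁) (N * L₂) (N.apply a) := by
  rw [linearDiffPoly, linearDiffPoly, DiffOp.apply_map_add, DiffOp.apply_map_add,
    DiffOp.mul_apply, DiffOp.mul_apply, ← MvPolynomial.algebraMap_eq, DiffOp.apply_algebraMap]

theorem der_linearDiffPoly [CommRing F] [Differential F] (k : ℕ) (L₁ L₂ : DiffOp F) (a : F) :
    der k (linearDiffPoly L₁ L₂ a) =
      linearDiffPoly (DiffOp.delta ^ k * L₁) (DiffOp.delta ^ k * L₂)
        ((DiffOp.delta ^ k : DiffOp F).apply a) :=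
  (DiffOp.delta_pow_apply (F := F) k _).symm.trans (apply_linearDiffPoly _ _ _ _)

theorem aeval_apply_X [CommRing F] [Differential F] {σ K : Type*} [CommRing K] [Algebra F K]
    (g : DiffOp F →ₗ[F] K) {s : σ × ℕ → K} {j : σ} (hs : ∀ k, s (j, k) = g (DiffOp.delta ^ k))
    (L : DiffOp F) :
    MvPolynomial.aeval s (L.apply (MvPolynomial.X (j, 0) : DiffPoly σ F)) = g L := by
  induction L using DiffOp.induction_on with
  | add L M hL hM => rw [DiffOp.apply_add, map_add, map_add, hL, hM]
  | ofField_mul_delta_pow c k =>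
    rw [DiffOp.ofField_mul_delta_pow_apply, der_X, zero_add, map_mul, AlgHom.commutes,
      MvPolynomial.aeval_X, hs, ← DiffOp.smul_eq_ofField_mul, map_smul, Algebra.smul_def]

theorem aeval_linearDiffPoly [CommRing F] [Differential F] (f : DiffOp F × DiffOp F × F →ₗ[F] F)
    (hf : f (0, 0, 1) = 1) (M₁ M₂ : DiffOp F) (b : F) :
    MvPolynomial.aeval
      (fun v : Fin 2 × ℕ => f (![(DiffOp.delta ^ v.2, 0, 0), (0, DiffOp.delta ^ v.2, 0)] v.1))
      (linearDiffPoly M₁ M₂ b) = f (M₁, M₂, b) := by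
  have hb : (M₁, M₂, b) = (M₁, 0, 0) + (0, M₂, 0) + b • (0, 0, 1) := by simp
  rw [linearDiffPoly, map_add, map_add,
    aeval_apply_X (f ∘ₗ LinearMap.inl F _ _) fun _ => rfl,
    aeval_apply_X (f ∘ₗ LinearMap.inr F _ _ ∘ₗ LinearMap.inl F _ _) fun _ => rfl,
    MvPolynomial.aeval_C, hb, map_add, map_add, map_smul, hf, smul_eq_mul, mul_one]
  rfl

/-- The map `N ↦ (N L₁, N L₂, N(a))`, that is, `N ↦ N(A)` for `A = L₁(x) + L₂(y) + a` with
`M₁(x) + M₂(y) + b` encoded as `(M₁, M₂, b)`. -/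
def leftMultiples [CommRing F] [Differential F] (L₁ L₂ : DiffOp F) (a : F) :
    DiffOp F →ₗ[F] DiffOp F × DiffOp F × F where
  toFun N := (N * L₁, N * L₂, N.apply a)
  map_add' N N' := by rw [add_mul, add_mul, DiffOp.apply_add]; rfl
  map_smul' c N := by
    simp only [DiffOp.smul_eq_ofField_mul, mul_assoc, DiffOp.ofField_mul_apply, RingHom.id_apply,
      Prod.smul_mk, Algebra.algebraMap_self_apply, smul_eq_mul]

theorem leftMultiples_apply [CommRing F] [Differential F] (L₁ L₂ : DiffOp F) (a : F)
    (N : DiffOp F) : leftMultiples L₁ L₂ a N = (N * L₁, N * L₂, N.apply a) := rfl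

theorem zero_zero_one_notMem_range_leftMultiples [Field F] [Differential F] {L₁ L₂ : DiffOp F}
    (h : L₁ ≠ 0 ∨ L₂ ≠ 0) (a : F) :
    (0, 0, 1) ∉ LinearMap.range (leftMultiples L₁ L₂ a) := by
  rintro ⟨N, hN⟩
  obtain ⟨h₁, h₂, ha⟩ : N * L₁ = 0 ∧ N * L₂ = 0 ∧ N.apply a = 1 := by
    simpa only [leftMultiples_apply, Prod.mk.injEq] using hN
  have hN0 : N = 0 := h.elim (mul_eq_zero.1 h₁).resolve_right (mul_eq_zero.1 h₂).resolve_right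
  rw [hN0, DiffOp.zero_apply] at ha
  exact zero_ne_one ha

theorem linearDiffPoly_mem_diffSpan_iff [Field F] [Differential F] {L₁ L₂ : DiffOp F}
    (h : L₁ ≠ 0 ∨ L₂ ≠ 0) {a : F} {M₁ M₂ : DiffOp F} {b : F} :
    linearDiffPoly M₁ M₂ b ∈ diffSpan {linearDiffPoly L₁ L₂ a} ↔
      ∃ N : DiffOp F, M₁ = N * L₁ ∧ M₂ = N * L₂ ∧ b = N.apply a := by
  constructor
  · intro hM
    suffices (M₁, M₂, b) ∈ LinearMap.range (leftMultiples L₁ L₂ a) by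
      obtain ⟨N, hN⟩ := this
      simp only [leftMultiples_apply, Prod.mk.injEq] at hN
      exact ⟨N, hN.1.symm, hN.2.1.symm, hN.2.2.symm⟩
    by_contra hv
    obtain ⟨f, hfW, hf1, hfv⟩ :=
      exists_linearMap_eq_one_ne_zero (zero_zero_one_notMem_range_leftMultiples h a) hv
    rw [← aeval_linearDiffPoly f hf1] at hfv
    refine hfv ((Ideal.span_le (I := RingHom.ker (MvPolynomial.aeval _))).2 ?_ hM)
    rintro _ ⟨_, rfl, k, rfl⟩
    rw [der_linearDiffPoly]
    exact (aeval_linearDiffPoly f hf1 _ _ _).trans (hfW ⟨DiffOp.delta ^ k, rfl⟩)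
  · rintro ⟨N, rfl, rfl, rfl⟩
    rw [← apply_linearDiffPoly]
    exact (isDiffIdeal_diffSpan _).apply_mem N (subset_diffSpan _ rfl)

end LinearMembers

section DerivComap

variable {F E : Type*} [Field F] [Differential F] [Field E] [Differential E] [Algebra F E]
  [DifferentialAlgebra F E]

/-- The field of the elements of `M` whose derivative also lies in `M`. It measures how far `M` is
from being closed under the derivation. -/
def derivComap (M : IntermediateField F E) : IntermediateField F E where
  carrier := {z | z ∈ M ∧ z′ ∈ M}
  mul_mem' {y z} hy hz := ⟨mul_mem hy.1 hz.1, by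
    rw [Derivation.leibniz, smul_eq_mul, smul_eq_mul]
    exact add_mem (mul_mem hy.1 hz.2) (mul_mem hz.1 hy.2)⟩
  add_mem' {y z} hy hz := ⟨add_mem hy.1 hz.1, by
    rw [map_add]
    exact add_mem hy.2 hz.2⟩
  algebraMap_mem' c := ⟨M.algebraMap_mem c, by
    rw [deriv_algebraMap]
    exact M.algebraMap_mem _⟩
  inv_mem' z hz := ⟨inv_mem hz.1, by
    rw [Derivation.leibniz_inv, smul_eq_mul]
    exact mul_mem (neg_mem (pow_mem (inv_mem hz.1) 2)) hz.2⟩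

variable {M : IntermediateField F E}

theorem mem_derivComap {z : E} : z ∈ derivComap M ↔ z ∈ M ∧ z′ ∈ M := Iff.rfl

theorem aeval_mem_of_derivComap {x : E} (hx : x ∈ M) (p : Polynomial (derivComap M)) :
    Polynomial.aeval x p ∈ M := by
  rw [Polynomial.aeval_eq_sum_range]
  exact sum_mem fun i _ => mul_mem (p.coeff i).2.1 (pow_mem hx i)

theorem deriv_aeval_sub_mem {x : E} (hx : x ∈ M) (p : Polynomial (derivComap M)) :
    (Polynomial.aeval x p)′ - Polynomial.aeval x (Polynomial.derivative p) * x′ ∈ M := by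
  induction p using Polynomial.induction_on' with
  | add p q hp hq =>
    simp only [map_add, add_mul, add_sub_add_comm]
    exact add_mem hp hq
  | monomial i c =>
    have h : (Polynomial.aeval x (Polynomial.monomial i c))′ -
        Polynomial.aeval x (Polynomial.derivative (Polynomial.monomial i c)) * x′ =
          x ^ i * (c : E)′ := by
      simp only [Polynomial.derivative_monomial, Polynomial.aeval_monomial, Derivation.leibniz,
        Derivation.leibniz_pow, map_mul, map_natCast, smul_eq_mul, nsmul_eq_mul,
        IntermediateField.algebraMap_apply]
      ring
    rw [h]
    exact mul_mem (pow_mem hx i) c.2.2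

theorem mem_derivComap_of_isAlgebraic [CharZero F] {x : E} (hx : x ∈ M)
    (h : IsAlgebraic (derivComap M) x) : x ∈ derivComap M := by
  have hsep : (minpoly (derivComap M) x).Separable := (minpoly.irreducible h.isIntegral).separable
  have hmem := deriv_aeval_sub_mem hx (minpoly (derivComap M) x)
  rw [minpoly.aeval, map_zero, zero_sub, neg_mem_iff] at hmem
  refine ⟨hx, ?_⟩
  rw [← mul_div_cancel_left₀ x′ (hsep.aeval_derivative_ne_zero (minpoly.aeval _ x))]
  exact div_mem hmem (aeval_mem_of_derivComap hx _)

end DerivComap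

section DiffAdjoin

variable {F E : Type*} [Field F] [Field E] [Differential E] [Algebra F E]

theorem subset_diffAdjoin (S : Set E) : S ⊆ diffAdjoin F S :=
  fun s hs => IntermediateField.subset_adjoin _ _ ⟨s, hs, 0, rfl⟩

theorem self_mem_diffAdjoin (u : E) : u ∈ diffAdjoin F {u} :=
  subset_diffAdjoin {u} (Set.mem_singleton u)

theorem diffAdjoin_empty : diffAdjoin F (∅ : Set E) = ⊥ := by
  simp [diffAdjoin]

variable [Differential F] [DifferentialAlgebra F E] {S T : Set E}

theorem diffAdjoin_le_derivComap (S : Set E) :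
    diffAdjoin F S ≤ derivComap (diffAdjoin F S) := by
  refine IntermediateField.adjoin_le_iff.2 ?_
  rintro _ ⟨s, hs, k, rfl⟩
  exact ⟨IntermediateField.subset_adjoin _ _ ⟨s, hs, k, rfl⟩,
    IntermediateField.subset_adjoin _ _ ⟨s, hs, k + 1, (der_succ k s).symm⟩⟩

theorem der_mem_diffAdjoin (k : ℕ) {z : E} (hz : z ∈ diffAdjoin F S) :
    der k z ∈ diffAdjoin F S := by
  induction k with
  | zero => exact hz
  | succ k ih => exact der_succ k z ▸ (diffAdjoin_le_derivComap S ih).2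

theorem apply_mem_diffAdjoin (L : DiffOp F) {z : E} (hz : z ∈ diffAdjoin F S) :
    L.apply z ∈ diffAdjoin F S :=
  sum_mem fun _ _ => mul_mem (IntermediateField.algebraMap_mem _ _) (der_mem_diffAdjoin _ hz)

theorem diffAeval_mem_diffAdjoin {σ : Type*} {η : σ → E} (hη : ∀ j, η j ∈ diffAdjoin F S)
    (f : DiffPoly σ F) : diffAeval η f ∈ diffAdjoin F S := by
  induction f using MvPolynomial.induction_on with
  | C c =>
    rw [← MvPolynomial.algebraMap_eq, AlgHom.commutes]
    exact IntermediateField.algebraMap_mem _ c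
  | add p q hp hq =>
    rw [map_add]
    exact add_mem hp hq
  | mul_X p v hp =>
    rw [map_mul, diffAeval_X]
    exact mul_mem hp (der_mem_diffAdjoin _ (hη _))

theorem diffAdjoin_le (h : S ⊆ diffAdjoin F T) : diffAdjoin F S ≤ diffAdjoin F T := by
  refine IntermediateField.adjoin_le_iff.2 ?_
  rintro _ ⟨s, hs, k, rfl⟩
  exact der_mem_diffAdjoin k (h hs)

end DiffAdjoin

theorem isAlgebraic_of_mem_adjoin_simple {K D E : Type*} [Field K] [Field D] [Field E]
    [Algebra K D] [Algebra K E] [Algebra D E] [IsScalarTower K D E] {x : E} {w : D}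
    (hw : algebraMap D E w ∈ IntermediateField.adjoin K {x})
    (hwK : w ∉ Set.range (algebraMap K D)) : IsAlgebraic D x := by
  obtain ⟨p, q, hpq⟩ := (IntermediateField.mem_adjoin_simple_iff K _).1 hw
  have hq : Polynomial.aeval x q ≠ 0 := by
    intro hq
    rw [hq, div_zero, map_eq_zero] at hpq
    exact hwK ⟨0, by rw [hpq, map_zero]⟩
  refine ⟨Polynomial.C w * q.map (algebraMap K D) - p.map (algebraMap K D), fun h0 => ?_, ?_⟩
  · obtain ⟨i, hi⟩ : ∃ i, q.coeff i ≠ 0 := by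
      by_contra! h
      exact hq (by rw [Polynomial.ext (q := 0) h, map_zero])
    have hwi := congrArg (Polynomial.coeff · i) h0
    simp only [Polynomial.coeff_sub, Polynomial.coeff_C_mul, Polynomial.coeff_map,
      Polynomial.coeff_zero, sub_eq_zero] at hwi
    refine hwK ⟨p.coeff i / q.coeff i, ?_⟩
    rw [map_div₀, ← hwi, mul_div_cancel_right₀ _ ((map_ne_zero _).2 hi)]
  · rw [map_sub, map_mul, Polynomial.aeval_C, Polynomial.aeval_map_algebraMap,
      Polynomial.aeval_map_algebraMap, hpq, div_mul_cancel₀ _ hq, sub_self]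

section DerivativeTower

variable (F : Type*) {E : Type*} [Field F] [Field E] [Differential E] [Algebra F E]

/-- The field `F(u, u′, …, u^(n-1))`. -/
def derField (u : E) (n : ℕ) : IntermediateField F E :=
  IntermediateField.adjoin F ((fun k => der k u) '' Set.Iio n)

variable {F} {u : E}

theorem der_mem_derField {k n : ℕ} (h : k < n) : der k u ∈ derField F u n :=
  IntermediateField.subset_adjoin _ _ ⟨k, h, rfl⟩

theorem derField_mono : Monotone (derField F u) := fun _ _ h =>
  IntermediateField.adjoin.mono _ _ _ (Set.image_mono (Set.Iio_subset_Iio h))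

theorem derField_zero : derField F u 0 = ⊥ := by
  rw [derField, show Set.Iio 0 = (∅ : Set ℕ) from isMin_bot.Iio_eq, Set.image_empty,
    IntermediateField.adjoin_empty]

theorem derField_succ (n : ℕ) : derField F u (n + 1) =
    (IntermediateField.adjoin (derField F u n) {der n u}).restrictScalars F := by
  have h : Set.Iio (n + 1) = Set.Iio n ∪ {n} := by
    ext k
    simp only [Set.mem_Iio, Set.mem_union, Set.mem_singleton_iff, Nat.lt_succ_iff_lt_or_eq]
  rw [derField, h, Set.image_union, Set.image_singleton, ← IntermediateField.adjoin_adjoin_left]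
  rfl

theorem exists_mem_derField {w : E} (hw : w ∈ diffAdjoin F {u}) : ∃ n, w ∈ derField F u n := by
  have h : diffAdjoin F {u} = ⨆ n, derField F u n := by
    unfold diffAdjoin derField
    rw [← IntermediateField.adjoin_iUnion]
    congr 1
    ext z
    simp only [Set.mem_singleton_iff, exists_eq_left, Set.mem_ofPred_eq, Set.mem_iUnion,
      Set.mem_image, Set.mem_Iio]
    exact ⟨fun ⟨k, h⟩ => ⟨k + 1, k, k.lt_succ_self, h.symm⟩, fun ⟨_, k, _, h⟩ => ⟨k, h.symm⟩⟩
  rwa [h, ← SetLike.mem_coe, IntermediateField.coe_iSup_of_directed derField_mono.directed_le,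
    Set.mem_iUnion] at hw

theorem DiffTranscendental.der_notMem_derField (hu : DiffTranscendental F u) (n : ℕ) :
    der n u ∉ derField F u n := by
  intro hmem
  have h := AlgebraicIndependent.transcendental_adjoin hu (s := Set.Iio n) (i := n) (by simp)
  open scoped IntermediateField.algebraAdjoinAdjoin in
  exact h ((IsFractionRing.isAlgebraic_iff _ (IntermediateField.adjoin F
    ((fun k => der k u) '' Set.Iio n)) E).2
      (isAlgebraic_algebraMap (⟨der n u, hmem⟩ : derField F u n)))

theorem der_natDegree_mem {D : DiffOp F} (hD : D ≠ 0) {w : E} {M : IntermediateField F E}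
    (hDw : D.apply w ∈ M) (hlt : ∀ i < (DiffOp.toPoly D).natDegree, der i w ∈ M) :
    der (DiffOp.toPoly D).natDegree w ∈ M := by
  have hlc : algebraMap F E (DiffOp.toPoly D).leadingCoeff ≠ 0 := by
    rwa [map_ne_zero, Polynomial.leadingCoeff_ne_zero, EmbeddingLike.map_ne_zero_iff]
  have hsum : D.apply w = ∑ i ∈ Finset.range ((DiffOp.toPoly D).natDegree + 1),
      algebraMap F E (D.coeff i) * der i w :=
    Polynomial.sum_over_range _ fun i => by rw [map_zero, zero_mul]
  rw [Finset.sum_range_succ] at hsum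
  have hlead : algebraMap F E (DiffOp.toPoly D).leadingCoeff * der _ w = D.apply w - _ :=
    eq_sub_iff_add_eq'.2 hsum.symm
  rw [← mul_div_cancel_left₀ (der _ w) hlc, hlead]
  exact div_mem (sub_mem hDw (sum_mem fun i hi =>
    mul_mem (M.algebraMap_mem _) (hlt i (Finset.mem_range.1 hi)))) (M.algebraMap_mem _)

variable [Differential F] [DifferentialAlgebra F E]

theorem derField_le_derivComap (n : ℕ) : derField F u n ≤ derivComap (derField F u (n + 1)) := by
  refine IntermediateField.adjoin_le_iff.2 ?_
  rintro _ ⟨k, hk, rfl⟩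
  refine ⟨der_mem_derField (Nat.lt_succ_of_lt hk), ?_⟩
  rw [← der_succ]
  exact der_mem_derField (Nat.succ_lt_succ hk)

theorem der_mem_derField_add {n : ℕ} {w : E} (hw : w ∈ derField F u n) (k : ℕ) :
    der k w ∈ derField F u (n + k) := by
  induction k with
  | zero => exact hw
  | succ k ih => exact der_succ k w ▸ (derField_le_derivComap _ ih).2

/- If `w ∉ F(u, …, u^(n-1))` then `u^(n)` is algebraic over `F(u, …, u^(n-1), w)`. Were `w′` in
`F(u, …, u^(n))`, then so would be the derivative of `u^(n)`. -/
theorem DiffTranscendental.derivComap_derField_succ [CharZero F] (hu : DiffTranscendental F u)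
    (n : ℕ) : derivComap (derField F u (n + 1)) = derField F u n := by
  refine le_antisymm (fun w hw => ?_) (derField_le_derivComap n)
  by_contra hwn
  let _ : Algebra (derField F u n) (derivComap (derField F u (n + 1))) :=
    (IntermediateField.inclusion (derField_le_derivComap n)).toRingHom.toAlgebra
  have : IsScalarTower (derField F u n) (derivComap (derField F u (n + 1))) E :=
    .of_algebraMap_eq fun _ => rfl
  have halg : IsAlgebraic (derivComap (derField F u (n + 1))) (der n u) := by
    refine isAlgebraic_of_mem_adjoin_simple (K := derField F u n) (w := ⟨w, hw⟩) ?_ ?_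
    · rw [← IntermediateField.mem_restrictScalars F, ← derField_succ]
      exact hw.1
    · rintro ⟨v, hv⟩
      have hvw : (v : E) = w := congrArg Subtype.val hv
      exact hwn (hvw ▸ v.2)
  refine hu.der_notMem_derField (n + 1) ?_
  rw [der_succ]
  exact (mem_derivComap_of_isAlgebraic (der_mem_derField n.lt_succ_self) halg).2

theorem DiffTranscendental.mem_derField_of_der_mem [CharZero F] (hu : DiffTranscendental F u)
    {n k : ℕ} {w : E} (hw : w ∈ derField F u (n + 1)) (hk : der k w ∈ derField F u (n + k)) :
    w ∈ derField F u n := by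
  induction k with
  | zero => exact hk
  | succ k ih =>
    refine ih ?_
    rw [← hu.derivComap_derField_succ, mem_derivComap, ← der_succ]
    exact ⟨by simpa only [add_right_comm] using der_mem_derField_add hw k, hk⟩

theorem DiffTranscendental.mem_range_of_apply_mem_range [CharZero F]
    (hu : DiffTranscendental F u) {w : E} (hw : w ∈ diffAdjoin F {u}) {D : DiffOp F} (hD : D ≠ 0)
    (hDw : D.apply w ∈ Set.range (algebraMap F E)) : w ∈ Set.range (algebraMap F E) := by
  obtain ⟨n, hn⟩ := exists_mem_derField hw
  induction n with
  | zero => rwa [derField_zero, IntermediateField.mem_bot] at hn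
  | succ n ih =>
    refine ih (hu.mem_derField_of_der_mem hn (der_natDegree_mem hD ?_ fun i hi => ?_))
    · obtain ⟨b, hb⟩ := hDw
      exact hb ▸ IntermediateField.algebraMap_mem _ b
    · exact derField_mono (by lia) (der_mem_derField_add hn i)

end DerivativeTower

section UniversalExtension

variable {F E : Type*} [Field F] [Differential F] [Field E] [Differential E] [Algebra F E]
  [DifferentialAlgebra F E]

theorem IsUniversalExtension.exists_diffTranscendental (hE : IsUniversalExtension F E) :
    ∃ u : E, DiffTranscendental F u := by
  have hd : ∀ z ∈ (⊥ : IntermediateField F E), z′ ∈ (⊥ : IntermediateField F E) := by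
    rw [← diffAdjoin_empty]
    exact fun z hz => (diffAdjoin_le_derivComap ∅ hz).2
  let := subDifferential _ hd
  obtain ⟨η, hη⟩ := hE ⊥ hd ⟨∅, Set.finite_empty, diffAdjoin_empty.symm⟩ 1 ⊥ Ideal.isPrime_bot
    fun f hf => by rw [Ideal.mem_bot.1 hf, map_zero]; exact zero_mem _
  have hind : AlgebraicIndependent (⊥ : IntermediateField F E)
      (fun v : Fin 1 × ℕ => der v.2 (η v.1)) :=
    (RingHom.injective_iff_ker_eq_bot _).2 hη
  exact ⟨η 0, (hind.comp _ (Prod.mk_right_injective 0)).restrictScalars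
    (algebraMap F (⊥ : IntermediateField F E)).injective⟩

end UniversalExtension

section Necessity

namespace DiffOp

variable {F : Type*} [Field F] [Differential F] {L₁ L₂ : DiffOp F}

theorem isGCLD_one_of_forall_isUnit (h : ∀ D, D ∣ L₁ → D ∣ L₂ → IsUnit D) : IsGCLD L₁ L₂ 1 where
  monic := Polynomial.monic_one
  dvd_left := one_dvd L₁
  dvd_right := one_dvd L₂
  degree_le D h₁ h₂ := by rw [degree_eq_zero_of_isUnit (h D h₁ h₂), degree_one]

end DiffOp

variable {F E : Type*} [Field F] [Differential F] [Field E] [Differential E] [Algebra F E]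
  [DifferentialAlgebra F E] {R : Ranking (Fin 2)} {L₁ L₂ : DiffOp F} {a : F} {u : E}
  {η : Fin 2 → E}

theorem linearDiffPoly_mem_vanishingIdeal_iff :
    linearDiffPoly L₁ L₂ a ∈ vanishingIdeal F η ↔
      L₁.apply (η 0) + L₂.apply (η 1) + algebraMap F E a = 0 := by
  rw [← diffAeval_linearDiffPoly]
  rfl

theorem IsRationalParametrization.mem_diffAdjoin {A : DiffPoly (Fin 2) F}
    (h : IsRationalParametrization R A u η) (i : Fin 2) : η i ∈ diffAdjoin F {u} := by
  obtain ⟨P, Q, -, -, hη⟩ := h.rational i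
  have heval (f : DiffPoly Unit F) : diffEval F (fun _ => u) f ∈ diffAdjoin F {u} :=
    diffAeval_mem_diffAdjoin (fun _ => self_mem_diffAdjoin u) f
  rw [hη]
  exact div_mem (heval P) (heval Q)

theorem DiffTranscendental.isUnit_of_isGenericPoint [CharZero F] (hu : DiffTranscendental F u)
    (hη : ∀ i, η i ∈ diffAdjoin F {u})
    (hgen : IsGenericPoint F (diffSpan {linearDiffPoly L₁ L₂ a}) η) (h : L₁ ≠ 0 ∨ L₂ ≠ 0)
    {D : DiffOp F} (h₁ : D ∣ L₁) (h₂ : D ∣ L₂) : IsUnit D := by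
  obtain ⟨M₁, rfl⟩ := h₁
  obtain ⟨M₂, rfl⟩ := h₂
  have hD : D ≠ 0 := h.elim left_ne_zero_of_mul left_ne_zero_of_mul
  have hDw : D.apply (M₁.apply (η 0) + M₂.apply (η 1)) = algebraMap F E (-a) := by
    rw [map_neg, ← add_eq_zero_iff_eq_neg, DiffOp.apply_map_add, ← DiffOp.mul_apply,
      ← DiffOp.mul_apply, ← linearDiffPoly_mem_vanishingIdeal_iff, hgen]
    exact subset_diffSpan _ rfl
  obtain ⟨b, hb⟩ := hu.mem_range_of_apply_mem_range
    (add_mem (apply_mem_diffAdjoin M₁ (hη 0)) (apply_mem_diffAdjoin M₂ (hη 1))) hD ⟨_, hDw.symm⟩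
  have hmem : linearDiffPoly M₁ M₂ (-b) ∈ vanishingIdeal F η := by
    rw [linearDiffPoly_mem_vanishingIdeal_iff, map_neg, hb, add_neg_cancel]
  rw [hgen, linearDiffPoly_mem_diffSpan_iff h] at hmem
  obtain ⟨N, hN₁, hN₂, -⟩ := hmem
  have hND : N * D = 1 := by
    rcases h with hM | hM
    · exact mul_right_cancel₀ (right_ne_zero_of_mul hM) (by rw [mul_assoc, ← hN₁, one_mul])
    · exact mul_right_cancel₀ (right_ne_zero_of_mul hM) (by rw [mul_assoc, ← hN₂, one_mul])
  exact IsUnit.of_mul_eq_one_right N hND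

theorem IsRationalParametrization.isGCLD_one [CharZero F]
    (h : IsRationalParametrization R (linearDiffPoly L₁ L₂ a) u η) (h0 : L₁ ≠ 0 ∨ L₂ ≠ 0) :
    DiffOp.IsGCLD L₁ L₂ 1 := by
  have hgen := h.generic
  rw [sat_eq_diffSpan R (totalDegree_linearDiffPoly_le L₁ L₂ a)] at hgen
  exact DiffOp.isGCLD_one_of_forall_isUnit fun D =>
    h.parameter.isUnit_of_isGenericPoint h.mem_diffAdjoin hgen h0

end Necessity

section EuclideanAlgorithm

namespace DiffOp

/-- The matrix `(0 1; 1 -Q)` of one division step: it carries `(R', R)` to `(R, R' - R Q)`. -/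
def euclidStep {S : Type*} [Ring S] (Q : S) : (Matrix (Fin 2) (Fin 2) S)ˣ where
  val := !![0, 1; 1, -Q]
  inv := !![Q, 1; 1, 0]
  val_inv := by simp [Matrix.one_fin_two]
  inv_val := by simp [Matrix.one_fin_two]

variable {F : Type*} [Field F] [Differential F]

/-- The matrix `(A_{n-1} A_n; B_{n-1} B_n)` of the cofactors returned by the extended left
Euclidean algorithm. -/
def ELEOutput.cofactorMatrix (T : ELEOutput F) : Matrix (Fin 2) (Fin 2) (DiffOp F) :=
  !![T.A', T.A; T.B', T.B]

theorem exists_eleLoop_cofactorMatrix_eq_mul (R' A' B' R A B : DiffOp F) :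
    ∃ U : (Matrix (Fin 2) (Fin 2) (DiffOp F))ˣ,
      (eleLoop R' A' B' R A B).cofactorMatrix = !![A', A; B', B] * U.val ∧
        ![R', R] ᵥ* U.val = ![(eleLoop R' A' B' R A B).R, 0] := by
  fun_induction eleLoop R' A' B' R A B with
  | case1 R' A' B' A B => exact ⟨1, (mul_one _).symm, Matrix.vecMul_one _⟩
  | case2 R' A' B' R A B _ ih =>
    obtain ⟨U, hU, hrow⟩ := ih
    refine ⟨euclidStep (lquo R' R) * U, ?_, ?_⟩
    · rw [hU, Units.val_mul, ← mul_assoc]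
      simp [euclidStep, sub_eq_add_neg]
    · rw [← hrow, Units.val_mul, ← Matrix.vecMul_vecMul]
      simp [euclidStep, lrem, sub_eq_add_neg]

theorem exists_ele_cofactorMatrix_eq (L₁ L₂ : DiffOp F) :
    ∃ U : (Matrix (Fin 2) (Fin 2) (DiffOp F))ˣ, (ele L₁ L₂).cofactorMatrix = U.val ∧
      ![L₁, L₂] ᵥ* U.val = ![(ele L₁ L₂).R, 0] := by
  obtain ⟨U, hU, hR⟩ := exists_eleLoop_cofactorMatrix_eq_mul L₁ 1 0 L₂ 0 1
  exact ⟨U, by rw [ele, hU, ← Matrix.one_fin_two, one_mul], hR⟩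

theorem IsGCLD.exists_ele_eq_ofField {L₁ L₂ : DiffOp F} (hG : IsGCLD L₁ L₂ 1) :
    ∃ c, c ≠ 0 ∧ (ele L₁ L₂).R = ofField c := by
  obtain ⟨U, -, hU⟩ := exists_ele_cofactorMatrix_eq L₁ L₂
  have hL : ![L₁, L₂] = ![(ele L₁ L₂).R, 0] ᵥ* U⁻¹.val := by
    rw [← hU, Matrix.vecMul_vecMul, Units.mul_inv, Matrix.vecMul_one]
  have h₁ : L₁ = (ele L₁ L₂).R * U⁻¹.val 0 0 := by
    simpa [Matrix.vecMul, dotProduct] using congrFun hL 0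
  have h₂ : L₂ = (ele L₁ L₂).R * U⁻¹.val 0 1 := by
    simpa [Matrix.vecMul, dotProduct] using congrFun hL 1
  obtain ⟨c, hc⟩ := exists_eq_ofField
    ((hG.degree_le _ (Dvd.intro _ h₁.symm) (Dvd.intro _ h₂.symm)).trans degree_one.le)
  refine ⟨c, ?_, hc⟩
  rintro rfl
  rw [hc, ofField_zero, zero_mul] at h₁ h₂
  have hdelta : (delta : DiffOp F).degree ≤ (1 : DiffOp F).degree :=
    hG.degree_le _ (h₁ ▸ dvd_zero _) (h₂ ▸ dvd_zero _)
  rw [degree_one, show (delta : DiffOp F).degree = 1 from Polynomial.degree_X] at hdelta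
  exact absurd hdelta (by decide)

end DiffOp

end EuclideanAlgorithm

section Matrices

variable {m n F K : Type*} [Fintype n] [CommRing F] [CommRing K] [Differential K] [Algebra F K]

/-- The value `∑ⱼ Lⱼ(zⱼ)` of a row of differential operators at a vector over a differential
`F`-algebra. -/
def applyDot (L : n → DiffOp F) (z : n → K) : K := ∑ j, (L j).apply (z j)

/-- The action of a matrix of differential operators on a vector over a differential
`F`-algebra, by rows. -/
def applyVec (T : Matrix m n (DiffOp F)) (z : n → K) : m → K := fun i => applyDot (T i) z

theorem linearDiffPoly_eq_applyDot [Differential F] (L₁ L₂ : DiffOp F) (a : F) :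
    linearDiffPoly L₁ L₂ a =
      applyDot ![L₁, L₂] (fun j => MvPolynomial.X (j, 0)) + MvPolynomial.C a := by
  simp [linearDiffPoly, applyDot]

variable [Differential F]

theorem applyVec_one [DecidableEq n] (z : n → K) : applyVec (1 : Matrix n n (DiffOp F)) z = z := by
  ext i
  refine (Finset.sum_eq_single i (fun j _ hj => ?_) (by simp)).trans ?_
  · rw [Matrix.one_apply_ne' hj, DiffOp.zero_apply]
  · rw [Matrix.one_apply_eq, DiffOp.one_apply]

variable [DifferentialAlgebra F K]

theorem applyDot_applyVec [Fintype m] (L : m → DiffOp F) (T : Matrix m n (DiffOp F)) (z : n → K) :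
    applyDot L (applyVec T z) = applyDot (L ᵥ* T) z := by
  simp only [applyDot, applyVec, Matrix.vecMul, dotProduct, DiffOp.sum_apply, DiffOp.apply_sum,
    DiffOp.mul_apply]
  exact Finset.sum_comm

theorem applyVec_applyVec {l : Type*} [Fintype m] (S : Matrix l m (DiffOp F))
    (T : Matrix m n (DiffOp F)) (z : n → K) : applyVec S (applyVec T z) = applyVec (S * T) z :=
  funext fun i => (applyDot_applyVec (S i) T z).trans
    (congrArg (applyDot · z) (Matrix.mul_apply_eq_vecMul S T i).symm)

theorem applyVec_inv_applyVec [DecidableEq n] (U : (Matrix n n (DiffOp F))ˣ) (z : n → K) :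
    applyVec U⁻¹.val (applyVec U.val z) = z := by
  rw [applyVec_applyVec, Units.inv_mul, applyVec_one]

theorem applyVec_applyVec_inv [DecidableEq n] (U : (Matrix n n (DiffOp F))ˣ) (z : n → K) :
    applyVec U.val (applyVec U⁻¹.val z) = z := by
  rw [applyVec_applyVec, Units.mul_inv, applyVec_one]

theorem diffAeval_applyVec {σ : Type*} (η : σ → K) (T : Matrix m n (DiffOp F))
    (f : n → DiffPoly σ F) (i : m) :
    diffAeval η (applyVec T f i) = applyVec T (fun j => diffAeval η (f j)) i := by
  simp only [applyVec, applyDot, map_sum, diffAeval_apply]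

end Matrices

theorem IsDiffIdeal.applyVec_sub_applyVec_mem {σ m n F : Type*} [Fintype n] [CommRing F]
    [Differential F] {I : Ideal (DiffPoly σ F)} (hI : IsDiffIdeal I) (T : Matrix m n (DiffOp F))
    {f g : n → DiffPoly σ F} (h : ∀ j, f j - g j ∈ I) (i : m) :
    applyVec T f i - applyVec T g i ∈ I := by
  simp only [applyVec, applyDot, ← Finset.sum_sub_distrib, ← DiffOp.apply_map_sub]
  exact sum_mem fun j _ => hI.apply_mem _ (h j)

section Sufficiency

variable {F E : Type*} [Field F] [Differential F] [Field E] [Differential E] [Algebra F E]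
  [DifferentialAlgebra F E]

theorem diffAdjoin_range_applyVec_le {m n : Type*} [Fintype n] (T : Matrix m n (DiffOp F))
    (z : n → E) : diffAdjoin F (Set.range (applyVec T z)) ≤ diffAdjoin F (Set.range z) := by
  refine diffAdjoin_le ?_
  rintro _ ⟨i, rfl⟩
  exact sum_mem fun j _ => apply_mem_diffAdjoin _ (subset_diffAdjoin _ (Set.mem_range_self j))

theorem diffAdjoin_range_applyVec {n : Type*} [Fintype n] [DecidableEq n]
    (U : (Matrix n n (DiffOp F))ˣ) (z : n → E) :
    diffAdjoin F (Set.range (applyVec U.val z)) = diffAdjoin F (Set.range z) := by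
  refine le_antisymm (diffAdjoin_range_applyVec_le U.val z) ?_
  conv_lhs => rw [← applyVec_inv_applyVec U z]
  exact diffAdjoin_range_applyVec_le U⁻¹.val _

theorem diffAdjoin_range_algebraMap_cons (b : F) (u : E) :
    diffAdjoin F (Set.range ![algebraMap F E b, u]) = diffAdjoin F {u} := by
  refine le_antisymm (diffAdjoin_le ?_) (diffAdjoin_le (Set.singleton_subset_iff.2 ?_))
  · exact Set.forall_mem_range.2 (Fin.forall_fin_two.2
      ⟨IntermediateField.algebraMap_mem _ b, self_mem_diffAdjoin u⟩)
  · exact subset_diffAdjoin _ ⟨1, rfl⟩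

theorem exists_notMem_range_algebraMap {ι : Type*} {η : ι → E} {u : E}
    (hu : DiffTranscendental F u) (hη : u ∈ diffAdjoin F (Set.range η)) :
    ∃ i, η i ∉ Set.range (algebraMap F E) := by
  by_contra! h
  have hle : diffAdjoin F (Set.range η) ≤ ⊥ := by
    rw [← diffAdjoin_empty]
    refine diffAdjoin_le ?_
    rintro _ ⟨i, rfl⟩
    rw [diffAdjoin_empty]
    exact h i
  exact hu.der_notMem_derField 0 (derField_zero (F := F) (u := u) ▸ hle hη)

/- `W` inverts `P` modulo `I`: if `f(P(u)) = 0`, then `f(P) = 0` identically, and substituting `W`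
gives `f ∈ I`. -/
theorem DiffTranscendental.vanishingIdeal_eq {σ : Type*} {u : E} (hu : DiffTranscendental F u)
    {I : Ideal (DiffPoly σ F)} (hI : IsDiffIdeal I) {P : σ → DiffPoly Unit F} (W : DiffPoly σ F)
    (hW : ∀ j, diffAeval (fun _ => W) (P j) - MvPolynomial.X (j, 0) ∈ I)
    (hP : I ≤ vanishingIdeal F fun j => diffAeval (fun _ => u) (P j)) :
    vanishingIdeal F (fun j => diffAeval (fun _ => u) (P j)) = I := by
  refine le_antisymm (fun f hf => ?_) hP
  have hinj : Function.Injective (diffAeval (F := F) fun _ : Unit => u) :=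
    hu.comp (fun v : Unit × ℕ => v.2) fun _ _ h => Prod.ext rfl h
  have hfP : diffAeval P f = 0 :=
    hinj ((diffAeval_diffAeval _ P f).trans (Eq.trans hf (map_zero _).symm))
  have hfW := hI.diffAeval_sub_diffAeval_mem hW f
  rwa [← diffAeval_diffAeval, hfP, map_zero, diffAeval_X_zero, zero_sub, neg_mem_iff] at hfW

variable {U : (Matrix (Fin 2) (Fin 2) (DiffOp F))ˣ} {L₁ L₂ : DiffOp F} {c : F}

theorem applyDot_eq_mul_applyVec_inv {K : Type*} [CommRing K] [Differential K] [Algebra F K]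
    [DifferentialAlgebra F K] (hU : ![L₁, L₂] ᵥ* U.val = ![DiffOp.ofField c, 0]) (z : Fin 2 → K) :
    applyDot ![L₁, L₂] z = algebraMap F K c * applyVec U⁻¹.val z 0 := by
  conv_lhs => rw [← applyVec_applyVec_inv U z, applyDot_applyVec, hU]
  simp [applyDot, DiffOp.ofField_apply, DiffOp.zero_apply]

theorem linearDiffPoly_mem_vanishingIdeal_applyVec
    (hU : ![L₁, L₂] ᵥ* U.val = ![DiffOp.ofField c, 0]) (hc : c ≠ 0) (a : F) (u : E) :
    linearDiffPoly L₁ L₂ a ∈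
      vanishingIdeal F (applyVec U.val ![algebraMap F E (-a / c), u]) := by
  have h := applyDot_eq_mul_applyVec_inv hU (applyVec U.val ![algebraMap F E (-a / c), u])
  rw [applyVec_inv_applyVec, Matrix.cons_val_zero, ← map_mul, mul_div_cancel₀ _ hc, map_neg] at h
  rw [linearDiffPoly_mem_vanishingIdeal_iff, ← eq_neg_iff_add_eq_zero, ← h, applyDot,
    Fin.sum_univ_two]
  rfl

theorem applyVec_inv_X_sub_C_mem_diffSpan
    (hU : ![L₁, L₂] ᵥ* U.val = ![DiffOp.ofField c, 0]) (hc : c ≠ 0) (a : F) :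
    applyVec U⁻¹.val (fun j => MvPolynomial.X (j, 0)) 0 - MvPolynomial.C (-a / c) ∈
      diffSpan {linearDiffPoly L₁ L₂ a} := by
  have h : applyVec U⁻¹.val (fun j => MvPolynomial.X (j, 0)) 0 - MvPolynomial.C (-a / c) =
      MvPolynomial.C c⁻¹ * linearDiffPoly L₁ L₂ a := by
    rw [linearDiffPoly_eq_applyDot, applyDot_eq_mul_applyVec_inv hU, MvPolynomial.algebraMap_eq,
      mul_add, ← mul_assoc, ← map_mul, ← map_mul, inv_mul_cancel₀ hc, map_one, one_mul, neg_div,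
      map_neg, sub_neg_eq_add, div_eq_inv_mul]
  exact h ▸ Ideal.mul_mem_left _ _ (subset_diffSpan _ rfl)

theorem diffAeval_applyVec_C_X {m K : Type*} [CommRing K] [Differential K] [Algebra F K]
    [DifferentialAlgebra F K] (T : Matrix m (Fin 2) (DiffOp F)) (b : F) (z : K) (i : m) :
    diffAeval (fun _ : Unit => z) (applyVec T ![MvPolynomial.C b, MvPolynomial.X ((), 0)] i) =
      applyVec T ![algebraMap F K b, z] i := by
  rw [diffAeval_applyVec]
  congr 1
  exact funext (Fin.forall_fin_two.2 ⟨MvPolynomial.aeval_C _ _, diffAeval_X _ _ _⟩)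

theorem totalDegree_applyVec_C_X_le {m σ : Type*} (T : Matrix m (Fin 2) (DiffOp F)) (b : F) (j : σ)
    (i : m) : (applyVec T ![(MvPolynomial.C b : DiffPoly σ F), MvPolynomial.X (j, 0)] i).totalDegree
      ≤ 1 := by
  rw [applyVec, applyDot, Fin.sum_univ_two, Matrix.cons_val_zero, Matrix.cons_val_one,
    ← MvPolynomial.algebraMap_eq, DiffOp.apply_algebraMap, MvPolynomial.algebraMap_eq]
  refine (MvPolynomial.totalDegree_add _ _).trans (max_le ?_ (totalDegree_apply_X_le _ _))
  exact (MvPolynomial.totalDegree_C _).trans_le zero_le_one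

theorem DiffTranscendental.isGenericPoint_applyVec {u : E} (hu : DiffTranscendental F u)
    (hU : ![L₁, L₂] ᵥ* U.val = ![DiffOp.ofField c, 0]) (hc : c ≠ 0) (a : F) :
    IsGenericPoint F (diffSpan {linearDiffPoly L₁ L₂ a})
      (applyVec U.val ![algebraMap F E (-a / c), u]) := by
  let W : Fin 2 → DiffPoly (Fin 2) F := applyVec U⁻¹.val fun j => MvPolynomial.X (j, 0)
  have hW : applyVec U.val W = fun j => MvPolynomial.X (j, 0) := applyVec_applyVec_inv U _
  have hI := isDiffIdeal_diffSpan {linearDiffPoly L₁ L₂ a}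
  have hgen := hu.vanishingIdeal_eq hI
    (P := applyVec U.val ![MvPolynomial.C (-a / c), MvPolynomial.X ((), 0)]) (W 1)
  simp only [diffAeval_applyVec_C_X] at hgen
  refine hgen (fun i => ?_) ?_
  · rw [← congrFun hW i]
    refine hI.applyVec_sub_applyVec_mem U.val (Fin.forall_fin_two.2 ⟨?_, ?_⟩) i
    · rw [← neg_mem_iff, neg_sub]
      exact applyVec_inv_X_sub_C_mem_diffSpan hU hc a
    · exact (sub_self (W 1)).symm ▸ zero_mem _
  · exact (isDiffIdeal_vanishingIdeal _).diffSpan_le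
      (Set.singleton_subset_iff.2 (linearDiffPoly_mem_vanishingIdeal_applyVec hU hc a u))

theorem DiffTranscendental.isProperLinearPolyParametrization_applyVec {u : E}
    (hu : DiffTranscendental F u) (R : Ranking (Fin 2))
    (hU : ![L₁, L₂] ᵥ* U.val = ![DiffOp.ofField c, 0]) (hc : c ≠ 0) (a : F) :
    IsProperLinearPolyParametrization R (linearDiffPoly L₁ L₂ a) u
      (applyVec U.val ![algebraMap F E (-a / c), u]) := by
  have hproper : diffAdjoin F (Set.range (applyVec U.val ![algebraMap F E (-a / c), u])) =
      diffAdjoin F {u} :=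
    (diffAdjoin_range_applyVec U _).trans (diffAdjoin_range_algebraMap_cons _ u)
  have hlinear (i : Fin 2) : ∃ P : DiffPoly Unit F, P.totalDegree ≤ 1 ∧
      applyVec U.val ![algebraMap F E (-a / c), u] i = diffEval F (fun _ => u) P :=
    ⟨_, totalDegree_applyVec_C_X_le U.val (-a / c) () i, (diffAeval_applyVec_C_X U.val _ u i).symm⟩
  refine ⟨⟨hu, fun i => ?_, ?_⟩, hproper, hlinear, ?_⟩
  · obtain ⟨P, -, hP⟩ := hlinear i
    exact ⟨P, 1, one_ne_zero, isRelPrime_one_right, by rw [map_one, div_one, hP]⟩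
  · rw [sat_eq_diffSpan R (totalDegree_linearDiffPoly_le L₁ L₂ a)]
    exact hu.isGenericPoint_applyVec hU hc a
  · exact exists_notMem_range_algebraMap hu (hproper ▸ self_mem_diffAdjoin u)

theorem eleParametrization_eq_applyVec (T : DiffOp.ELEOutput F) (a c : F) (u : E) :
    eleParametrization T a c u = applyVec T.cofactorMatrix ![algebraMap F E (-a / c), u] := by
  refine funext (Fin.forall_fin_two.2 ⟨?_, ?_⟩) <;>
    rw [applyVec, applyDot, Fin.sum_univ_two, add_comm, Matrix.cons_val_zero, Matrix.cons_val_one,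
      DiffOp.apply_algebraMap] <;>
    rfl

theorem DiffOp.IsGCLD.exists_isProperLinearPolyParametrization_ele (hG : IsGCLD L₁ L₂ 1)
    (R : Ranking (Fin 2)) (a : F) :
    ∃ c : F, c ≠ 0 ∧ (ele L₁ L₂).R = ofField c ∧ ∀ u : E, DiffTranscendental F u →
      IsProperLinearPolyParametrization R (linearDiffPoly L₁ L₂ a) u
        (eleParametrization (ele L₁ L₂) a c u) := by
  obtain ⟨c, hc, hR⟩ := hG.exists_ele_eq_ofField
  obtain ⟨U, hT, hU⟩ := exists_ele_cofactorMatrix_eq L₁ L₂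
  rw [hR] at hU
  refine ⟨c, hc, hR, fun u hu => ?_⟩
  rw [eleParametrization_eq_applyVec, hT]
  exact hu.isProperLinearPolyParametrization_applyVec R hU hc a

end Sufficiency

end DiffAlg

end

theorem mainTheorem4_general {F : Type*} {E : Type*} [Field F] [CharZero F] [Differential F]
    [Field E] [Differential E] [Algebra F E] [DifferentialAlgebra F E]
    (hu : ∃ u : E, DiffAlg.DiffTranscendental F u) (R : DiffAlg.Ranking (Fin 2))
    (L₁ L₂ : DiffAlg.DiffOp F) (a : F)
    (hF : ∀ c : F, DiffAlg.linearDiffPoly L₁ L₂ a ≠ MvPolynomial.C c) :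
    (DiffAlg.IsUnirational E R (DiffAlg.linearDiffPoly L₁ L₂ a) ↔
      DiffAlg.DiffOp.IsGCLD L₁ L₂ 1) ∧
    (DiffAlg.IsUnirational E R (DiffAlg.linearDiffPoly L₁ L₂ a) →
      (∃ (u : E) (η : Fin 2 → E), DiffAlg.IsProperLinearPolyParametrization R
        (DiffAlg.linearDiffPoly L₁ L₂ a) u η) ∧
      ∃ c : F, c ≠ 0 ∧ (DiffAlg.DiffOp.ele L₁ L₂).R = DiffAlg.DiffOp.ofField c ∧
        ∀ u : E, DiffAlg.DiffTranscendental F u →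
          DiffAlg.IsProperLinearPolyParametrization R (DiffAlg.linearDiffPoly L₁ L₂ a) u
            (DiffAlg.eleParametrization (DiffAlg.DiffOp.ele L₁ L₂) a c u)) := by
  have h0 : L₁ ≠ 0 ∨ L₂ ≠ 0 := by
    by_contra! h
    refine hF a ?_
    rw [DiffAlg.linearDiffPoly, h.1, h.2, DiffAlg.DiffOp.zero_apply, DiffAlg.DiffOp.zero_apply,
      zero_add, zero_add]
  have hgcld : DiffAlg.IsUnirational E R (DiffAlg.linearDiffPoly L₁ L₂ a) →
      DiffAlg.DiffOp.IsGCLD L₁ L₂ 1 := fun ⟨_, _, _, h⟩ => h.isGCLD_one h0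
  have hirr : Irreducible (DiffAlg.linearDiffPoly L₁ L₂ a) :=
    DiffAlg.irreducible_of_totalDegree_le_one (DiffAlg.totalDegree_linearDiffPoly_le _ _ _) hF
  obtain ⟨u, hu⟩ := hu
  refine ⟨⟨hgcld, fun hG => ⟨hirr, ?_⟩⟩, fun hunirational => ?_⟩
  · obtain ⟨c, -, -, h⟩ := hG.exists_isProperLinearPolyParametrization_ele (E := E) R a
    exact ⟨u, _, (h u hu).toIsRationalParametrization⟩
  · have hele := (hgcld hunirational).exists_isProperLinearPolyParametrization_ele (E := E) R a
    refine ⟨?_, hele⟩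
    obtain ⟨c, -, -, h⟩ := hele
    exact ⟨u, _, h u hu⟩

theorem mainTheorem4 {F : Type*} {E : Type*} [Field F] [CharZero F] [Differential F]
    [Field E] [Differential E] [Algebra F E] [DifferentialAlgebra F E]
    (hE : DiffAlg.IsUniversalExtension F E) (R : DiffAlg.Ranking (Fin 2))
    (L₁ L₂ : DiffAlg.DiffOp F) (a : F)
    (hF : ∀ c : F, DiffAlg.linearDiffPoly L₁ L₂ a ≠ MvPolynomial.C c) :
    (DiffAlg.IsUnirational E R (DiffAlg.linearDiffPoly L₁ L₂ a) ↔
      DiffAlg.DiffOp.IsGCLD L₁ L₂ 1) ∧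
    (DiffAlg.IsUnirational E R (DiffAlg.linearDiffPoly L₁ L₂ a) →
      (∃ (u : E) (η : Fin 2 → E), DiffAlg.IsProperLinearPolyParametrization R
        (DiffAlg.linearDiffPoly L₁ L₂ a) u η) ∧
      ∃ c : F, c ≠ 0 ∧ (DiffAlg.DiffOp.ele L₁ L₂).R = DiffAlg.DiffOp.ofField c ∧
        ∀ u : E, DiffAlg.DiffTranscendental F u →
          DiffAlg.IsProperLinearPolyParametrization R (DiffAlg.linearDiffPoly L₁ L₂ a) u
            (DiffAlg.eleParametrization (DiffAlg.DiffOp.ele L₁ L₂) a c u)) :=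
  mainTheorem4_general hE.exists_diffTranscendental R L₁ L₂ a hF
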